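/- **Theorem 5.** Consider a cellular network with $L$ cells, each with one base station (BS) with $M$ antennas and $K$ single-antenna users (UEs), where $L,K$ are fixed. For every $M$, let $\mathbf h_{jli}\sim\mathcal{CN}(\mathbf 0,\mathbf R_{jli})$, with $\mathbf R_{jli}\in\mathbb C^{M\times M}$, be the channel from UE $i$ in cell $l$ to BS $j$, and let $\mathbf n_{ji}\sim\mathcal{CN}(\mathbf 0,\mathbf I_M)$ be the noise in the pilot phase; at each BS $j$, the vectors $\mathbf h_{jli}$ $(1\le l\le L,\ 1\le i\le K)$ and $\mathbf n_{ji}$ $(1\le i\le K)$ are mutually independent. There are $\tau_p=K$ pilots, the $i$-th one being used by UE $i$ of every cell, and coherence blocks of $\tau_c>\tau_p$ channel uses. Let $\rho^{\rm tr},\rho^{\rm ul},\rho^{\rm dl}>0$ be fixed powers. Put $$\mathbf Q_{ji}=\sum_{l=1}^L\mathbf R_{jli}+\tfrac1{\rho^{\rm tr}}\mathbf I_M,\qquad \mathbf\Phi_{jli}=\mathbf R_{jli}\mathbf Q_{ji}^{-1}\mathbf R_{jli},\qquad \mathbf Z_j=\sum_{l=1}^L\sum_{i=1}^K(\mathbf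 R_{jli}-\mathbf\Phi_{jli})+\tfrac1{\rho^{\rm ul}}\mathbf I_M,$$ $$\hat{\mathbf h}_{jli}=\mathbf R_{jli}\mathbf Q_{ji}^{-1}\Big(\sum_{l'=1}^L\mathbf h_{jl'i}+\tfrac1{\sqrt{\rho^{\rm tr}}}\mathbf n_{ji}\Big)$$ (the MMSE channel estimates), and let M-MMSE precoding be given by $$\mathbf v_{jk}=\Big(\sum_{l=1}^L\sum_{i=1}^K\hat{\mathbf h}_{jli}\hat{\mathbf h}_{jli}^{\rm H}+\mathbf Z_j\Big)^{-1}\hat{\mathbf h}_{jjk},\qquad \mathbf w_{jk}=\frac{\mathbf v_{jk}}{\sqrt{\mathbb E\{\|\mathbf v_{jk}\|^2\}}}.$$ The downlink effective SINR and spectral efficiency (SE) of UE $k$ in cell $j$ are $$\gamma^{\rm dl}_{jk}=\frac{|\mathbb E\{\mathbf h_{jjk}^{\rm H}\mathbf w_{jk}\}|^2}{\sum_{l=1}^L\sum_{i=1}^K\mathbb E\{|\mathbf h_{ljk}^{\rm H}\mathbf w_{li}|^2\}-|\mathbb E\{\mathbf h_{jjk}^{\rm H}\mathbf w_{jk}\}|^2+\frac1{\rho^{\rm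 dl}}},\qquad \mathsf{SE}^{\rm dl}_{jk}=\Big(1-\frac{\tau_p}{\tau_c}\Big)\log_2\big(1+\gamma^{\rm dl}_{jk}\big).$$ Assume that, as $M\to\infty$, (i) for all $j,l,i$: $\liminf_M\frac1M\operatorname{tr}(\mathbf R_{jli})>0$ and $\limsup_M\|\mathbf R_{jli}\|_2<\infty$ (spectral norm); (ii) for all $j,k$ and all $l'\in\{1,\dots,L\}$: $\displaystyle\liminf_M\ \inf_{\boldsymbol\lambda\in\mathbb R^L,\ \lambda_{l'}=1}\ \frac1M\Big\|\sum_{l=1}^L\lambda_l\mathbf R_{jlk}\Big\|_F^2>0$ (Frobenius norm). Then all the expectations above exist, $\mathbb E\{\|\mathbf w_{jk}\|^2\}=1$ for all sufficiently large $M$, and for every UE $k$ in every cell $j$ we have $\gamma^{\rm dl}_{jk}\to\infty$ as $M\to\infty$; hence $\mathsf{SE}^{\rm dl}_{jk}\to\infty$ as $M\to\infty$. -/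

import Mathlib

open MeasureTheory ProbabilityTheory Filter
open scoped Matrix

noncomputable section

namespace MulticellMIMO

section Norms

open scoped Matrix.Norms.Frobenius in
/-- Frobenius norm of a complex square matrix. -/
def frobeniusNorm {M : ℕ} (A : Matrix (Fin M) (Fin M) ℂ) : ℝ := ‖A‖

open scoped Matrix.Norms.L2Operator in
/-- Spectral norm (operator norm for the Euclidean norm) of a complex square matrix. -/
def specNorm {M : ℕ} (A : Matrix (Fin M) (Fin M) ℂ) : ℝ := ‖A‖

end Norms

/-- Squared Euclidean norm of a complex vector. -/
def normSq {M : ℕ} (x : Fin M → ℂ) : ℝ := ∑ m, ‖x m‖ ^ 2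

/-- `X ∼ CN(0, R)`: the random vector `X` is jointly Gaussian and circularly symmetric (zero mean,
zero pseudo-covariance `E[X Xᵀ] = 0`) with covariance matrix `E[X Xᴴ] = R`. -/
structure IsCN {M : ℕ} {Ω : Type*} [MeasurableSpace Ω] (X : Ω → Fin M → ℂ)
    (R : Matrix (Fin M) (Fin M) ℂ) (P : Measure Ω) : Prop where
  gaussian : HasGaussianLaw X P
  mean : ∀ m, ∫ ω, X ω m ∂P = 0
  covariance : ∀ m n, ∫ ω, X ω m * star (X ω n) ∂P = R m n
  pseudoCovariance : ∀ m n, ∫ ω, X ω m * X ω n ∂P = 0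

/-- The statistical model with `L` cells, `K` users per cell and `M` antennas per base station.
`h j l i` is the channel from user `i` in cell `l` to base station `j`, with covariance matrix
`R j l i`, and `n j i` is the noise at base station `j` after despreading the `i`-th pilot
sequence, which is used by user `i` in every cell. At each base station the channels of the
different users and the pilot noise vectors are mutually independent. Nothing is assumed about the
dependence between the channels to different base stations. -/
structure IsChannelModel {L K M : ℕ} {Ω : Type*} [MeasurableSpace Ω] (P : Measure Ω)
    (R : Fin L → Fin L → Fin K → Matrix (Fin M) (Fin M) ℂ)
    (h : Fin L → Fin L → Fin K → Ω → Fin M → ℂ) (n : Fin L → Fin K → Ω → Fin M → ℂ) : Prop where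
  channel : ∀ j l i, IsCN (h j l i) (R j l i) P
  noise : ∀ j i, IsCN (n j i) 1 P
  indep : ∀ j, iIndepFun
    (Sum.elim (fun q : Fin L × Fin K => h j q.1 q.2) (fun i : Fin K => n j i)) P

section Scheme

/-- `Q_{ji} = ∑_{l'} R_{jl'i} + (1/ρtr) I`. -/
def pilotCov {L K M : ℕ} (ρtr : ℝ) (R : Fin L → Fin L → Fin K → Matrix (Fin M) (Fin M) ℂ)
    (j : Fin L) (i : Fin K) : Matrix (Fin M) (Fin M) ℂ :=
  ∑ l', R j l' i + ((1 / ρtr : ℝ) : ℂ) • (1 : Matrix (Fin M) (Fin M) ℂ)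

/-- `Φ_{jli} = R_{jli} Q_{ji}⁻¹ R_{jli}`. -/
def estCov {L K M : ℕ} (ρtr : ℝ) (R : Fin L → Fin L → Fin K → Matrix (Fin M) (Fin M) ℂ)
    (j l : Fin L) (i : Fin K) : Matrix (Fin M) (Fin M) ℂ :=
  R j l i * (pilotCov ρtr R j i)⁻¹ * R j l i

/-- `Z_j = ∑_l ∑_i (R_{jli} - Φ_{jli}) + (1/ρul) I`. -/
def errCov {L K M : ℕ} (ρtr ρul : ℝ) (R : Fin L → Fin L → Fin K → Matrix (Fin M) (Fin M) ℂ)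
    (j : Fin L) : Matrix (Fin M) (Fin M) ℂ :=
  ∑ l, ∑ i, (R j l i - estCov ρtr R j l i) +
    ((1 / ρul : ℝ) : ℂ) • (1 : Matrix (Fin M) (Fin M) ℂ)

/-- MMSE channel estimate
`ĥ_{jli} = R_{jli} Q_{ji}⁻¹ (∑_{l'} h_{jl'i} + n_{ji} / √ρtr)`. -/
def channelEst {L K M : ℕ} {Ω : Type*} (ρtr : ℝ)
    (R : Fin L → Fin L → Fin K → Matrix (Fin M) (Fin M) ℂ)
    (h : Fin L → Fin L → Fin K → Ω → Fin M → ℂ) (n : Fin L → Fin K → Ω → Fin M → ℂ)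
    (j l : Fin L) (i : Fin K) (ω : Ω) : Fin M → ℂ :=
  (R j l i * (pilotCov ρtr R j i)⁻¹) *ᵥ
    (∑ l', h j l' i ω + ((1 / Real.sqrt ρtr : ℝ) : ℂ) • n j i ω)

/-- M-MMSE combining vector
`v_{jk} = (∑_l ∑_i ĥ_{jli} ĥ_{jli}ᴴ + Z_j)⁻¹ ĥ_{jjk}`. -/
def combiner {L K M : ℕ} {Ω : Type*} (ρtr ρul : ℝ)
    (R : Fin L → Fin L → Fin K → Matrix (Fin M) (Fin M) ℂ)
    (h : Fin L → Fin L → Fin K → Ω → Fin M → ℂ) (n : Fin L → Fin K → Ω → Fin M → ℂ)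
    (j : Fin L) (k : Fin K) (ω : Ω) : Fin M → ℂ :=
  (∑ l, ∑ i, Matrix.vecMulVec (channelEst ρtr R h n j l i ω) (star (channelEst ρtr R h n j l i ω))
    + errCov ρtr ρul R j)⁻¹ *ᵥ channelEst ρtr R h n j j k ω

/-- M-MMSE precoding vector `w_{jk} = v_{jk} / √(E‖v_{jk}‖²)`. -/
def precoder {L K M : ℕ} {Ω : Type*} [MeasurableSpace Ω] (P : Measure Ω) (ρtr ρul : ℝ)
    (R : Fin L → Fin L → Fin K → Matrix (Fin M) (Fin M) ℂ)
    (h : Fin L → Fin L → Fin K → Ω → Fin M → ℂ) (n : Fin L → Fin K → Ω → Fin M → ℂ)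
    (j : Fin L) (k : Fin K) (ω : Ω) : Fin M → ℂ :=
  ((1 / Real.sqrt (∫ ω', normSq (combiner ρtr ρul R h n j k ω') ∂P) : ℝ) : ℂ) •
    combiner ρtr ρul R h n j k ω

end Scheme

/-- Downlink effective SINR of user `k` in cell `j` when base station `l` uses the (random)
precoding vectors `w l i`:
`|E[h_{jjk}ᴴ w_{jk}]|² / (∑_l ∑_i E|h_{ljk}ᴴ w_{li}|² - |E[h_{jjk}ᴴ w_{jk}]|² + 1/ρdl)`. -/
def downlinkSINR {L K M : ℕ} {Ω : Type*} [MeasurableSpace Ω] (P : Measure Ω) (ρdl : ℝ)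
    (h : Fin L → Fin L → Fin K → Ω → Fin M → ℂ) (w : Fin L → Fin K → Ω → Fin M → ℂ)
    (j : Fin L) (k : Fin K) : ℝ :=
  ‖∫ ω, star (h j j k ω) ⬝ᵥ w j k ω ∂P‖ ^ 2 /
    (∑ l, ∑ i, ∫ ω, ‖star (h l j k ω) ⬝ᵥ w l i ω‖ ^ 2 ∂P
      - ‖∫ ω, star (h j j k ω) ⬝ᵥ w j k ω ∂P‖ ^ 2 + 1 / ρdl)

/-- Downlink spectral efficiency `(1 - τp/τc) log₂ (1 + γ)`. -/
def spectralEfficiency (τp τc : ℕ) (γ : ℝ) : ℝ :=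
  (1 - (τp : ℝ) / (τc : ℝ)) * Real.logb 2 (1 + γ)

/-- `liminf_M (1/M) tr R_{jli} > 0` and `limsup_M ‖R_{jli}‖₂ < ∞` for all `j, l, i`. -/
def BoundedEnergy {L K : ℕ}
    (R : (M : ℕ) → Fin L → Fin L → Fin K → Matrix (Fin M) (Fin M) ℂ) : Prop :=
  ∀ j l i,
    (0 : EReal) < liminf (fun M : ℕ => ((1 / (M : ℝ) * (R M j l i).trace.re : ℝ) : EReal)) atTop ∧
    limsup (fun M : ℕ => ((specNorm (R M j l i) : ℝ) : EReal)) atTop < ⊤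

/-- Asymptotic linear independence of the covariance matrices of the users that share a pilot:
`liminf_M inf_{λ ∈ ℝ^L, λ_{l'} = 1} (1/M) ‖∑_l λ_l R_{jlk}‖_F² > 0` for all `j, k, l'`. -/
def AsymptoticallyIndependent {L K : ℕ}
    (R : (M : ℕ) → Fin L → Fin L → Fin K → Matrix (Fin M) (Fin M) ℂ) : Prop :=
  ∀ (j : Fin L) (k : Fin K) (l' : Fin L),
    (0 : EReal) < liminf (fun M : ℕ => ⨅ c ∈ {c : Fin L → ℝ | c l' = 1},
      ((1 / (M : ℝ) * frobeniusNorm (∑ l, ((c l : ℝ) : ℂ) • R M j l k) ^ 2 : ℝ) : EReal)) atTop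

end MulticellMIMO

end

/-!
No random matrix theory is needed. Fix a base station, write `y_i` for its pilot observations,
`ĥ` for the estimates, and `x = ĥ_bᴴ v_b` for the gain of the filter
`v_b = (∑ₐ ĥₐ ĥₐᴴ + Z)⁻¹ ĥ_b` on its own vector.

* The filter equation gives `∑ₐ |ĥₐᴴ v_b|² + v_bᴴ Z v_b = x`, so `x ∈ [0, 1]` and the interference
  as well as `‖v_b‖²` are at most a constant times `1 - x` (`mmseFilter_energy`).
* Everything therefore rests on `E[1 - x] = O(1 / M)` (`integral_one_sub_combinerGain_le`). By the
  variational characterisation of the filter (`one_sub_mmseGain_le`), any vector `u` bounds `1 - x`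
  by its mean squared error. Asymptotic independence yields a matrix `B` in the span of the
  covariance matrices `R_l` sharing the pilot with `tr (B R_l) / M = δ_{l,j}` and `‖B‖_F² = O(M)`
  (`exists_dual_combination`), and the choice `u = B y_k / M` makes `uᴴ ĥ_l` a quadratic form in
  `y_k` with mean `δ_{l,j}`. Its variance is `O(1 / M)`: for a centred Gaussian vector, comparing the
  form with an independent copy and rotating the pair by `π / 4` turns it into a bilinear form in two
  independent vectors, for which second moments suffice (`variance_quadraticForm_le`).
* The power `p = E‖v_b‖²` satisfies `p ≤ ρul E[1 - x]`, and, since `x ≤ ‖ĥ_b‖ ‖v_b‖`, also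
  `p ≥ 1 / (4 r M)`, where `r` bounds the spectral norms. The estimation errors are independent of
  all filters (`indepFun_estErr`) and contribute at most `r p`. After division by `p` every
  interference term is bounded, while the signal term is at least a multiple of `M`
  (`le_downlinkSINR`).
-/

noncomputable section

namespace MulticellMIMO

/-! ### Hermitian forms and the squared Euclidean norm -/

section HermitianForms

variable {M : ℕ}

lemma normSq_nonneg (x : Fin M → ℂ) : 0 ≤ normSq x :=
  Finset.sum_nonneg fun _ _ => by positivity

lemma normSq_pos {x : Fin M → ℂ} (hx : x ≠ 0) : 0 < normSq x := by
  obtain ⟨m, hm⟩ := Function.ne_iff.1 hx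
  exact Finset.sum_pos' (fun _ _ => by positivity)
    ⟨m, Finset.mem_univ _, pow_pos (norm_pos_iff.2 hm) 2⟩

lemma star_dotProduct_self (x : Fin M → ℂ) : star x ⬝ᵥ x = (normSq x : ℂ) := by
  simp only [dotProduct, Pi.star_apply, normSq, Complex.ofReal_sum, Complex.ofReal_pow]
  exact Finset.sum_congr rfl fun m _ => Complex.conj_mul' (x m)

lemma star_star_dotProduct (x y : Fin M → ℂ) : star (star x ⬝ᵥ y) = star y ⬝ᵥ x := by
  rw [← Matrix.star_dotProduct_star, star_star]

lemma norm_star_dotProduct_comm (x y : Fin M → ℂ) : ‖star x ⬝ᵥ y‖ = ‖star y ⬝ᵥ x‖ := by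
  rw [← star_star_dotProduct, norm_star]

lemma normSq_eq_norm_sq (x : Fin M → ℂ) : normSq x = ‖WithLp.toLp 2 x‖ ^ 2 := by
  rw [EuclideanSpace.norm_sq_eq]; rfl

/-- The Cauchy–Schwarz inequality. -/
lemma norm_star_dotProduct_sq_le (x y : Fin M → ℂ) :
    ‖star x ⬝ᵥ y‖ ^ 2 ≤ normSq x * normSq y := by
  have h := norm_inner_le_norm (𝕜 := ℂ) (WithLp.toLp 2 x) (WithLp.toLp 2 y)
  rw [EuclideanSpace.inner_toLp_toLp, dotProduct_comm] at h
  rw [normSq_eq_norm_sq, normSq_eq_norm_sq, ← mul_pow]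
  gcongr

lemma normSq_smul (c : ℂ) (x : Fin M → ℂ) : normSq (c • x) = ‖c‖ ^ 2 * normSq x := by
  simp [normSq, mul_pow, Finset.mul_sum]

lemma normSq_mulVec (B : Matrix (Fin M) (Fin M) ℂ) (x : Fin M → ℂ) :
    normSq (B *ᵥ x) = ∑ m, ‖star (star (B m)) ⬝ᵥ x‖ ^ 2 := by
  simp [normSq, Matrix.mulVec]

lemma frobeniusNorm_sq (B : Matrix (Fin M) (Fin M) ℂ) :
    frobeniusNorm B ^ 2 = ∑ m, normSq (star (B m)) := by
  have h : frobeniusNorm B = (∑ i, ∑ j, ‖B i j‖ ^ (2 : ℝ)) ^ (1 / 2 : ℝ) :=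
    Matrix.frobenius_norm_def B
  simp_rw [Real.rpow_two] at h
  rw [h, ← Real.sqrt_eq_rpow, Real.sq_sqrt (by positivity)]
  simp [normSq]

lemma re_star_dotProduct_mulVec_le (A : Matrix (Fin M) (Fin M) ℂ) (x : Fin M → ℂ) :
    (star x ⬝ᵥ A *ᵥ x).re ≤ specNorm A * normSq x := by
  have h1 : ‖WithLp.toLp 2 (A *ᵥ x)‖ ≤ specNorm A * ‖WithLp.toLp 2 x‖ :=
    Matrix.l2_opNorm_mulVec A (WithLp.toLp 2 x)
  have h2 := norm_inner_le_norm (𝕜 := ℂ) (WithLp.toLp 2 x) (WithLp.toLp 2 (A *ᵥ x))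
  rw [EuclideanSpace.inner_toLp_toLp, dotProduct_comm] at h2
  calc (star x ⬝ᵥ A *ᵥ x).re ≤ ‖star x ⬝ᵥ A *ᵥ x‖ := Complex.re_le_norm _
    _ ≤ ‖WithLp.toLp 2 x‖ * (specNorm A * ‖WithLp.toLp 2 x‖) := h2.trans (by gcongr)
    _ = specNorm A * normSq x := by rw [normSq_eq_norm_sq]; ring

lemma star_dotProduct_mulVec_comm {A : Matrix (Fin M) (Fin M) ℂ} (hA : A.IsHermitian)
    (x y : Fin M → ℂ) : star (star x ⬝ᵥ A *ᵥ y) = star y ⬝ᵥ A *ᵥ x := by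
  rw [star_star_dotProduct, Matrix.star_mulVec, hA.eq, Matrix.dotProduct_mulVec]

lemma trace_mul_eq_re {A B : Matrix (Fin M) (Fin M) ℂ} (hA : A.IsHermitian) (hB : B.IsHermitian) :
    (A * B).trace = ((A * B).trace.re : ℂ) := by
  refine (Complex.conj_eq_iff_re.1 ?_).symm
  rw [starRingEnd_apply, ← Matrix.trace_conjTranspose, Matrix.conjTranspose_mul, hA.eq, hB.eq,
    Matrix.trace_mul_comm]

lemma re_trace_mul_self {B : Matrix (Fin M) (Fin M) ℂ} (hB : B.IsHermitian) :
    (B * B).trace.re = frobeniusNorm B ^ 2 := by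
  rw [frobeniusNorm_sq]
  have h : (B * B).trace = ∑ m, ∑ n, ((‖B m n‖ ^ 2 : ℝ) : ℂ) := by
    simp only [Matrix.trace, Matrix.diag, Matrix.mul_apply]
    refine Finset.sum_congr rfl fun m _ => Finset.sum_congr rfl fun n _ => ?_
    rw [← hB.apply n m, Complex.ofReal_pow, ← Complex.mul_conj']
    rfl
  rw [h]
  simp only [← Complex.ofReal_sum, Complex.ofReal_re]
  simp [normSq]

lemma isUnit_of_coercive {A : Matrix (Fin M) (Fin M) ℂ} {z : ℝ} (hz : 0 < z)
    (hA : ∀ x, z * normSq x ≤ (star x ⬝ᵥ A *ᵥ x).re) : IsUnit A := by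
  rw [← Matrix.mulVec_injective_iff_isUnit, ← Matrix.coe_mulVecLin, ← LinearMap.ker_eq_bot,
    LinearMap.ker_eq_bot']
  intro x hx
  by_contra hx0
  have h := hA x
  rw [Matrix.mulVecLin_apply] at hx
  rw [hx, dotProduct_zero, Complex.zero_re] at h
  linarith [mul_pos hz (normSq_pos hx0)]

end HermitianForms

/-! ### The regularised MMSE filter -/

section MMSEFilter

variable {M : ℕ} {ι : Type*} [Fintype ι]

/-- The regularised sample covariance `∑ₐ gₐ gₐᴴ + Z`. -/
def gramPlus (g : ι → Fin M → ℂ) (Z : Matrix (Fin M) (Fin M) ℂ) : Matrix (Fin M) (Fin M) ℂ :=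
  ∑ a, Matrix.vecMulVec (g a) (star (g a)) + Z

lemma star_dotProduct_gramPlus_mulVec (g : ι → Fin M → ℂ) (Z : Matrix (Fin M) (Fin M) ℂ)
    (x y : Fin M → ℂ) :
    star x ⬝ᵥ gramPlus g Z *ᵥ y
      = ∑ a, (star x ⬝ᵥ g a) * (star (g a) ⬝ᵥ y) + star x ⬝ᵥ Z *ᵥ y := by
  rw [gramPlus, Matrix.add_mulVec, dotProduct_add, Matrix.sum_mulVec, dotProduct_sum]
  congr 1
  refine Finset.sum_congr rfl fun a _ => ?_
  rw [Matrix.vecMulVec_mulVec, op_smul_eq_smul, dotProduct_smul, smul_eq_mul, mul_comm]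

lemma re_gramPlus_self (g : ι → Fin M → ℂ) (Z : Matrix (Fin M) (Fin M) ℂ) (x : Fin M → ℂ) :
    (star x ⬝ᵥ gramPlus g Z *ᵥ x).re
      = ∑ a, ‖star (g a) ⬝ᵥ x‖ ^ 2 + (star x ⬝ᵥ Z *ᵥ x).re := by
  rw [star_dotProduct_gramPlus_mulVec, Complex.add_re, Complex.re_sum]
  congr 1
  refine Finset.sum_congr rfl fun a _ => ?_
  rw [← star_star_dotProduct, ← starRingEnd_apply, Complex.conj_mul']
  norm_cast

lemma isHermitian_gramPlus (g : ι → Fin M → ℂ) {Z : Matrix (Fin M) (Fin M) ℂ}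
    (hZ : Z.IsHermitian) : (gramPlus g Z).IsHermitian := by
  refine Matrix.IsHermitian.add ?_ hZ
  rw [Matrix.IsHermitian, Matrix.conjTranspose_sum]
  exact Finset.sum_congr rfl fun a _ => by rw [Matrix.conjTranspose_vecMulVec, star_star]

variable {g : ι → Fin M → ℂ} {Z : Matrix (Fin M) (Fin M) ℂ} {z : ℝ}

lemma isUnit_gramPlus (hz : 0 < z) (hZz : ∀ x, z * normSq x ≤ (star x ⬝ᵥ Z *ᵥ x).re) :
    IsUnit (gramPlus g Z) := by
  refine isUnit_of_coercive hz fun x => ?_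
  have h3 : 0 ≤ ∑ a, ‖star (g a) ⬝ᵥ x‖ ^ 2 := by positivity
  rw [re_gramPlus_self]
  linarith [hZz x]

/-- The filter `(∑ₐ gₐ gₐᴴ + Z)⁻¹ g_b`. -/
def mmseFilter (g : ι → Fin M → ℂ) (Z : Matrix (Fin M) (Fin M) ℂ) (b : ι) : Fin M → ℂ :=
  (gramPlus g Z)⁻¹ *ᵥ g b

/-- The gain `g_bᴴ v_b` of the filter on its own vector. -/
def mmseGain (g : ι → Fin M → ℂ) (Z : Matrix (Fin M) (Fin M) ℂ) (b : ι) : ℝ :=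
  (star (g b) ⬝ᵥ mmseFilter g Z b).re

lemma gramPlus_mulVec_mmseFilter (hz : 0 < z)
    (hZz : ∀ x, z * normSq x ≤ (star x ⬝ᵥ Z *ᵥ x).re) (b : ι) :
    gramPlus g Z *ᵥ mmseFilter g Z b = g b := by
  rw [mmseFilter, Matrix.mulVec_mulVec,
    Matrix.mul_nonsing_inv _ ((Matrix.isUnit_iff_isUnit_det _).1 (isUnit_gramPlus hz hZz)),
    Matrix.one_mulVec]

lemma star_dotProduct_mmseFilter (hz : 0 < z) (hZ : Z.IsHermitian)
    (hZz : ∀ x, z * normSq x ≤ (star x ⬝ᵥ Z *ᵥ x).re) (b : ι) :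
    star (g b) ⬝ᵥ mmseFilter g Z b = (mmseGain g Z b : ℂ) := by
  refine (Complex.conj_eq_iff_re.1 ?_).symm
  have h := gramPlus_mulVec_mmseFilter (g := g) hz hZz b
  have h2 := star_dotProduct_mulVec_comm (isHermitian_gramPlus g hZ)
    (mmseFilter g Z b) (mmseFilter g Z b)
  rw [h] at h2
  rw [starRingEnd_apply, star_star_dotProduct, ← h2, star_star_dotProduct]

/-- The energy identity for the filter: interference, noise and squared gain add up to the gain. -/
lemma mmseFilter_energy (hz : 0 < z)
    (hZz : ∀ x, z * normSq x ≤ (star x ⬝ᵥ Z *ᵥ x).re) (b : ι) :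
    ∑ a, ‖star (g a) ⬝ᵥ mmseFilter g Z b‖ ^ 2
      + (star (mmseFilter g Z b) ⬝ᵥ Z *ᵥ mmseFilter g Z b).re = mmseGain g Z b := by
  rw [← re_gramPlus_self, gramPlus_mulVec_mmseFilter hz hZz, mmseGain, ← star_star_dotProduct]
  exact Complex.conj_re _

lemma mmseFilter_interference_le [DecidableEq ι] (hz : 0 < z) (hZ : Z.IsHermitian)
    (hZz : ∀ x, z * normSq x ≤ (star x ⬝ᵥ Z *ᵥ x).re) (b : ι) :
    ∑ a ∈ Finset.univ.erase b, ‖star (g a) ⬝ᵥ mmseFilter g Z b‖ ^ 2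
      + z * normSq (mmseFilter g Z b) ≤ mmseGain g Z b - mmseGain g Z b ^ 2 := by
  have h := mmseFilter_energy (g := g) hz hZz b
  rw [← Finset.add_sum_erase _ _ (Finset.mem_univ b), star_dotProduct_mmseFilter hz hZ hZz,
    Complex.norm_real, Real.norm_eq_abs, sq_abs] at h
  have := hZz (mmseFilter g Z b)
  linarith

lemma mmseGain_mem_Icc (hz : 0 < z) (hZ : Z.IsHermitian)
    (hZz : ∀ x, z * normSq x ≤ (star x ⬝ᵥ Z *ᵥ x).re) (b : ι) :
    mmseGain g Z b ∈ Set.Icc (0 : ℝ) 1 := by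
  classical
  have h := mmseFilter_interference_le (g := g) hz hZ hZz b
  have h1 : 0 ≤ ∑ a ∈ Finset.univ.erase b, ‖star (g a) ⬝ᵥ mmseFilter g Z b‖ ^ 2 := by positivity
  have h2 := mul_nonneg hz.le (normSq_nonneg (mmseFilter g Z b))
  constructor <;> nlinarith

lemma normSq_mmseFilter_le (hz : 0 < z) (hZ : Z.IsHermitian)
    (hZz : ∀ x, z * normSq x ≤ (star x ⬝ᵥ Z *ᵥ x).re) (b : ι) :
    z * normSq (mmseFilter g Z b) ≤ 1 - mmseGain g Z b := by
  classical
  have h := mmseFilter_interference_le (g := g) hz hZ hZz b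
  have h1 : 0 ≤ ∑ a ∈ Finset.univ.erase b, ‖star (g a) ⬝ᵥ mmseFilter g Z b‖ ^ 2 := by positivity
  nlinarith [sq_nonneg (1 - mmseGain g Z b)]

lemma norm_sq_star_dotProduct_mmseFilter_le (hz : 0 < z) (hZ : Z.IsHermitian)
    (hZz : ∀ x, z * normSq x ≤ (star x ⬝ᵥ Z *ᵥ x).re) {a b : ι} (hab : a ≠ b) :
    ‖star (g a) ⬝ᵥ mmseFilter g Z b‖ ^ 2 ≤ 1 - mmseGain g Z b := by
  classical
  have h := mmseFilter_interference_le (g := g) hz hZ hZz b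
  have h1 := Finset.single_le_sum (f := fun a => ‖star (g a) ⬝ᵥ mmseFilter g Z b‖ ^ 2)
    (fun _ _ => by positivity) (Finset.mem_erase.2 ⟨hab, Finset.mem_univ a⟩)
  have h2 := mul_nonneg hz.le (normSq_nonneg (mmseFilter g Z b))
  nlinarith [sq_nonneg (1 - mmseGain g Z b)]

/-- The filter minimises the mean squared error: every vector `u` gives an upper bound for the
residual `1 - g_bᴴ v_b`. -/
lemma one_sub_mmseGain_le [DecidableEq ι] (hz : 0 < z) (hZ : Z.IsHermitian)
    (hZz : ∀ x, z * normSq x ≤ (star x ⬝ᵥ Z *ᵥ x).re) (b : ι) (u : Fin M → ℂ) :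
    1 - mmseGain g Z b
      ≤ ∑ a, ‖(if a = b then 1 else 0) - star u ⬝ᵥ g a‖ ^ 2 + (star u ⬝ᵥ Z *ᵥ u).re := by
  set v := mmseFilter g Z b with hv
  set A := gramPlus g Z with hA
  have hAv : A *ᵥ v = g b := gramPlus_mulVec_mmseFilter hz hZz b
  -- Completing the square: `(u - v)ᴴ A (u - v) ≥ 0`.
  have h0 : 0 ≤ (star (u - v) ⬝ᵥ A *ᵥ (u - v)).re := by
    rw [hA, re_gramPlus_self]
    have := (mul_nonneg hz.le (normSq_nonneg (u - v))).trans (hZz (u - v))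
    positivity
  have h1 : (star v ⬝ᵥ A *ᵥ u).re = (star u ⬝ᵥ g b).re := by
    rw [← star_dotProduct_mulVec_comm (isHermitian_gramPlus g hZ) u v, ← hA, hAv]
    exact Complex.conj_re _
  have h2 : (star v ⬝ᵥ g b).re = mmseGain g Z b := by
    rw [mmseGain, ← star_star_dotProduct]
    exact Complex.conj_re _
  rw [Matrix.mulVec_sub, hAv, star_sub, sub_dotProduct, dotProduct_sub, dotProduct_sub,
    Complex.sub_re, Complex.sub_re, Complex.sub_re, h1, h2, hA, re_gramPlus_self] at h0
  have h3 : ∑ a, ‖(if a = b then 1 else 0) - star u ⬝ᵥ g a‖ ^ 2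
      = ∑ a, ‖star (g a) ⬝ᵥ u‖ ^ 2 + (1 - 2 * (star u ⬝ᵥ g b).re) := by
    have h4 : ∀ a, ‖(if a = b then 1 else 0) - star u ⬝ᵥ g a‖ ^ 2
        = ‖star (g a) ⬝ᵥ u‖ ^ 2 + if a = b then 1 - 2 * (star u ⬝ᵥ g b).re else 0 := by
      intro a
      rw [norm_star_dotProduct_comm (g a) u]
      split_ifs with hab
      · subst hab
        rw [Complex.sq_norm, Complex.sq_norm, Complex.normSq_sub]
        simp
        ring
      · simp
    simp_rw [h4, Finset.sum_add_distrib, Finset.sum_ite_eq', Finset.mem_univ, if_true]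
  rw [h3]
  linarith

/-- The filter depends continuously on the vectors `gₐ`. -/
lemma continuous_mmseFilter (hz : 0 < z)
    (hZz : ∀ x, z * normSq x ≤ (star x ⬝ᵥ Z *ᵥ x).re) (b : ι) :
    Continuous fun g : ι → Fin M → ℂ => mmseFilter g Z b := by
  have hA : Continuous fun g : ι → Fin M → ℂ => gramPlus g Z :=
    (continuous_finsetSum _ fun a _ =>
      (continuous_apply a).matrix_vecMulVec (continuous_apply a).star).add continuous_const
  have hdet : ∀ g : ι → Fin M → ℂ, (gramPlus g Z).det ≠ 0 := fun g =>
    ((Matrix.isUnit_iff_isUnit_det _).1 (isUnit_gramPlus hz hZz)).ne_zero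
  have hinv : Continuous fun g : ι → Fin M → ℂ => (gramPlus g Z)⁻¹ := by
    simp_rw [Matrix.inv_def, Ring.inverse_eq_inv']
    exact (hA.matrix_det.inv₀ hdet).smul hA.matrix_adjugate
  exact hinv.matrix_mulVec (continuous_apply b)

end MMSEFilter

/-! ### Asymptotically independent covariance matrices -/

/-- Uniform linear independence provides a matrix in the span of the `R l` that is dual to `R l₀`
for the normalised trace form and has Frobenius norm of order `√M`. -/
lemma exists_dual_combination {L M : ℕ} (R : Fin L → Matrix (Fin M) (Fin M) ℂ)
    (hR : ∀ l, (R l).IsHermitian) {δ : ℝ} (hδ : 0 < δ)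
    (hind : ∀ (l' : Fin L) (c : Fin L → ℝ), c l' = 1 →
      δ ≤ 1 / (M : ℝ) * frobeniusNorm (∑ l, ((c l : ℝ) : ℂ) • R l) ^ 2) (l₀ : Fin L) :
    ∃ B : Matrix (Fin M) (Fin M) ℂ, B.IsHermitian ∧
      (∀ l, (1 / (M : ℂ)) * (B * R l).trace = if l = l₀ then 1 else 0) ∧
      1 / (M : ℝ) * frobeniusNorm B ^ 2 ≤ 1 / δ := by
  set B : (Fin L → ℝ) → Matrix (Fin M) (Fin M) ℂ := fun c => ∑ l, ((c l : ℝ) : ℂ) • R l with hBdef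
  have hB : ∀ c, (B c).IsHermitian := by
    intro c
    rw [Matrix.IsHermitian, hBdef, Matrix.conjTranspose_sum]
    refine Finset.sum_congr rfl fun l _ => ?_
    rw [Matrix.conjTranspose_smul, (hR l).eq]
    simp
  have hBsmul : ∀ (t : ℝ) c, B (t • c) = (t : ℂ) • B c := by
    intro t c
    simp [hBdef, Finset.smul_sum, smul_smul]
  have hfrob : ∀ (t : ℝ) c, frobeniusNorm (B (t • c)) ^ 2 = t ^ 2 * frobeniusNorm (B c) ^ 2 := by
    intro t c
    rw [hBsmul, frobeniusNorm_sq, frobeniusNorm_sq, Finset.mul_sum]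
    refine Finset.sum_congr rfl fun m _ => ?_
    have : star (((t : ℂ) • B c) m) = (t : ℂ) • star (B c m) := by
      ext n
      simp
    rw [this, normSq_smul, Complex.norm_real, Real.norm_eq_abs, sq_abs]
  -- The trace form bounds every coefficient from above.
  have hcoef : ∀ c l', δ * c l' ^ 2 ≤ 1 / (M : ℝ) * frobeniusNorm (B c) ^ 2 := by
    intro c l'
    by_cases hc : c l' = 0
    · rw [hc]
      have : 0 ≤ 1 / (M : ℝ) * frobeniusNorm (B c) ^ 2 := by positivity
      simpa using this
    · have h := hind l' ((c l')⁻¹ • c) (by simp [hc])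
      change δ ≤ 1 / (M : ℝ) * frobeniusNorm (B ((c l')⁻¹ • c)) ^ 2 at h
      rw [hfrob] at h
      calc δ * c l' ^ 2 ≤ 1 / (M : ℝ) * ((c l')⁻¹ ^ 2 * frobeniusNorm (B c) ^ 2) * c l' ^ 2 := by
            gcongr
        _ = _ := by field_simp
  let T : (Fin L → ℝ) →ₗ[ℝ] (Fin L → ℝ) :=
    { toFun := fun c l => 1 / (M : ℝ) * (B c * R l).trace.re
      map_add' := by
        intro c d
        ext l
        simp [hBdef, add_smul, Finset.sum_add_distrib, add_mul, mul_add]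
      map_smul' := by
        intro t c
        ext l
        rw [hBsmul]
        simp [mul_left_comm] }
  have hT : ∀ c l, T c l = 1 / (M : ℝ) * (B c * R l).trace.re := fun _ _ => rfl
  have hquad : ∀ c, ∑ l, c l * T c l = 1 / (M : ℝ) * frobeniusNorm (B c) ^ 2 := by
    intro c
    rw [← re_trace_mul_self (hB c)]
    have h1 : B c * B c = ∑ l, ((c l : ℝ) : ℂ) • (B c * R l) := by
      conv_lhs => rw [show B c * B c = B c * ∑ l, ((c l : ℝ) : ℂ) • R l from rfl, Finset.mul_sum]
      simp
    rw [h1, Matrix.trace_sum, Complex.re_sum, Finset.mul_sum]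
    refine Finset.sum_congr rfl fun l _ => ?_
    rw [hT, Matrix.trace_smul, smul_eq_mul, Complex.re_ofReal_mul]
    ring
  have hinj : Function.Injective T := by
    rw [← LinearMap.ker_eq_bot, LinearMap.ker_eq_bot']
    intro c hc
    ext l
    have h1 := hquad c
    rw [hc] at h1
    have h2 := hcoef c l
    rw [← h1] at h2
    have h3 : δ * c l ^ 2 ≤ 0 := by simpa using h2
    have h4 : c l ^ 2 ≤ 0 := by nlinarith [sq_nonneg (c l)]
    exact pow_eq_zero_iff (two_ne_zero) |>.1 (le_antisymm h4 (sq_nonneg _))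
  obtain ⟨c, hc⟩ := (LinearMap.injective_iff_surjective.1 hinj) (Pi.single l₀ 1)
  have hnorm : 1 / (M : ℝ) * frobeniusNorm (B c) ^ 2 = c l₀ := by
    rw [← hquad, hc]
    simp [Pi.single_apply]
  refine ⟨B c, hB c, fun l => ?_, ?_⟩
  · rw [trace_mul_eq_re (hB c) (hR l)]
    have h1 := hT c l
    rw [hc, Pi.single_apply] at h1
    have h2 := congrArg (fun t : ℝ => (t : ℂ)) h1
    push_cast at h2
    rw [← h2]
    split_ifs <;> simp
  · rw [hnorm, le_div_iff₀ hδ]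
    have h1 := hcoef c l₀
    rw [hnorm] at h1
    by_contra! h2
    nlinarith

/-! ### Random vectors with finite moments -/

section Moments

variable {Ω : Type*} [MeasurableSpace Ω] {P : Measure Ω}

/-- All moments of finite order exist. Unlike membership in a single `Lᵖ`, this is stable under
products. -/
def HasAllMoments {E : Type*} [NormedAddCommGroup E] (X : Ω → E) (P : Measure Ω) : Prop :=
  ∀ p : ENNReal, p ≠ ⊤ → MemLp X p P

namespace HasAllMoments

lemma add {E : Type*} [NormedAddCommGroup E] {X Y : Ω → E} (hX : HasAllMoments X P)
    (hY : HasAllMoments Y P) : HasAllMoments (fun ω => X ω + Y ω) P :=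
  fun p hp => (hX p hp).add (hY p hp)

lemma sub {E : Type*} [NormedAddCommGroup E] {X Y : Ω → E} (hX : HasAllMoments X P)
    (hY : HasAllMoments Y P) : HasAllMoments (fun ω => X ω - Y ω) P :=
  fun p hp => (hX p hp).sub (hY p hp)

lemma sum {E : Type*} [NormedAddCommGroup E] {ι : Type*} {s : Finset ι} {X : ι → Ω → E}
    (hX : ∀ i ∈ s, HasAllMoments (X i) P) : HasAllMoments (fun ω => ∑ i ∈ s, X i ω) P :=
  fun p hp => memLp_finsetSum s fun i hi => hX i hi p hp

lemma const [IsFiniteMeasure P] {E : Type*} [NormedAddCommGroup E] (c : E) :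
    HasAllMoments (fun _ : Ω => c) P :=
  fun _ _ => memLp_const c

lemma mul {X Y : Ω → ℂ} (hX : HasAllMoments X P) (hY : HasAllMoments Y P) :
    HasAllMoments (fun ω => X ω * Y ω) P := by
  intro p hp
  have : ENNReal.HolderTriple (2 * p) (2 * p) p := by
    refine ⟨?_⟩
    rw [ENNReal.mul_inv (by simp) (by simp), ← add_mul, ENNReal.inv_two_add_inv_two, one_mul]
  have h2 : 2 * p ≠ ⊤ := ENNReal.mul_ne_top (by simp) hp
  exact (hY _ h2).mul (hX _ h2)

lemma integrable {E : Type*} [NormedAddCommGroup E] {X : Ω → E} (hX : HasAllMoments X P) :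
    Integrable X P :=
  memLp_one_iff_integrable.1 (hX 1 (by simp))

lemma integrable_norm_sq {E : Type*} [NormedAddCommGroup E] {X : Ω → E}
    (hX : HasAllMoments X P) : Integrable (fun ω => ‖X ω‖ ^ 2) P :=
  (hX 2 (by simp)).integrable_norm_pow (by simp)

lemma aemeasurable {E : Type*} [NormedAddCommGroup E] [MeasurableSpace E] [BorelSpace E]
    {X : Ω → E} (hX : HasAllMoments X P) : AEMeasurable X P :=
  hX.integrable.aestronglyMeasurable.aemeasurable

lemma star_comp {E : Type*} [NormedAddCommGroup E] [StarAddMonoid E] [NormedStarGroup E]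
    {X : Ω → E} (hX : HasAllMoments X P) : HasAllMoments (fun ω => star (X ω)) P :=
  fun p hp => (hX p hp).star

section Vector

variable {ι κ : Type*} [Fintype ι] [Fintype κ] {X Y : Ω → ι → ℂ}

lemma eval (hX : HasAllMoments X P) (i : ι) : HasAllMoments (fun ω => X ω i) P :=
  fun p hp => (hX p hp).eval i

lemma of_eval (hX : ∀ i, HasAllMoments (fun ω => X ω i) P) : HasAllMoments X P :=
  fun p hp => MemLp.of_eval fun i => hX i p hp

lemma dotProduct (hX : HasAllMoments X P) (hY : HasAllMoments Y P) :
    HasAllMoments (fun ω => X ω ⬝ᵥ Y ω) P :=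
  .sum fun i _ => (hX.eval i).mul (hY.eval i)

lemma mulVec [IsFiniteMeasure P] (hX : HasAllMoments X P) (W : Matrix κ ι ℂ) :
    HasAllMoments (fun ω => W *ᵥ X ω) P :=
  .of_eval fun k => .dotProduct (const (W k)) hX

lemma smul [IsFiniteMeasure P] (hX : HasAllMoments X P) (c : ℂ) :
    HasAllMoments (fun ω => c • X ω) P :=
  .of_eval fun i => .mul (const c) (hX.eval i)

lemma integrable_normSq {M : ℕ} {X : Ω → Fin M → ℂ} (hX : HasAllMoments X P) :
    Integrable (fun ω => normSq (X ω)) P :=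
  integrable_finsetSum _ fun m _ => (hX.eval m).integrable_norm_sq

end Vector

end HasAllMoments

lemma _root_.ProbabilityTheory.HasGaussianLaw.hasAllMoments {E : Type*} [NormedAddCommGroup E]
    [NormedSpace ℝ E] [MeasurableSpace E] [BorelSpace E] [CompleteSpace E]
    [SecondCountableTopology E] {X : Ω → E} (hX : HasGaussianLaw X P) : HasAllMoments X P :=
  fun _ hp => hX.memLp hp

/-- The matrix of second moments `E[X Yᵀ]` of two complex random vectors. The cross-covariance
matrix of centred vectors is `secondMoment X (star Y)`. -/
def secondMoment {ι κ : Type*} (P : Measure Ω) (X : Ω → ι → ℂ) (Y : Ω → κ → ℂ) : Matrix ι κ ℂ :=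
  Matrix.of fun i k => ∫ ω, X ω i * Y ω k ∂P

section SecondMoment

variable {ι κ : Type*} [Fintype ι] [Fintype κ]

omit [Fintype ι] [Fintype κ] in
lemma transpose_secondMoment (X : Ω → ι → ℂ) (Y : Ω → κ → ℂ) :
    (secondMoment P X Y)ᵀ = secondMoment P Y X := by
  ext i k
  simp [secondMoment, mul_comm]

omit [Fintype ι] [Fintype κ] in
lemma secondMoment_star (X : Ω → ι → ℂ) (Y : Ω → κ → ℂ) :
    secondMoment P (fun ω => star (X ω)) (fun ω => star (Y ω))
      = (secondMoment P X Y).map star := by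
  ext i k
  simp only [secondMoment, Matrix.of_apply, Matrix.map_apply, Pi.star_apply,
    ← starRingEnd_apply, ← map_mul]
  exact integral_conj

lemma secondMoment_add_left {X X' : Ω → ι → ℂ} {Y : Ω → κ → ℂ} (hX : HasAllMoments X P)
    (hX' : HasAllMoments X' P) (hY : HasAllMoments Y P) :
    secondMoment P (fun ω => X ω + X' ω) Y = secondMoment P X Y + secondMoment P X' Y := by
  ext i k
  simp only [secondMoment, Matrix.of_apply, Matrix.add_apply, Pi.add_apply, add_mul]
  exact integral_add ((hX.eval i).mul (hY.eval k)).integrable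
    ((hX'.eval i).mul (hY.eval k)).integrable

lemma secondMoment_sub_left {X X' : Ω → ι → ℂ} {Y : Ω → κ → ℂ} (hX : HasAllMoments X P)
    (hX' : HasAllMoments X' P) (hY : HasAllMoments Y P) :
    secondMoment P (fun ω => X ω - X' ω) Y = secondMoment P X Y - secondMoment P X' Y := by
  ext i k
  simp only [secondMoment, Matrix.of_apply, Matrix.sub_apply, Pi.sub_apply, sub_mul]
  exact integral_sub ((hX.eval i).mul (hY.eval k)).integrable
    ((hX'.eval i).mul (hY.eval k)).integrable

lemma secondMoment_sum_left {α : Type*} {s : Finset α} {X : α → Ω → ι → ℂ} {Y : Ω → κ → ℂ}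
    (hX : ∀ a ∈ s, HasAllMoments (X a) P) (hY : HasAllMoments Y P) :
    secondMoment P (fun ω => ∑ a ∈ s, X a ω) Y = ∑ a ∈ s, secondMoment P (X a) Y := by
  ext i k
  simp only [secondMoment, Matrix.of_apply, Matrix.sum_apply, Finset.sum_apply, Finset.sum_mul]
  exact integral_finsetSum _ fun a ha => (((hX a ha).eval i).mul (hY.eval k)).integrable

omit [Fintype ι] [Fintype κ] in
lemma secondMoment_smul_left (c : ℂ) (X : Ω → ι → ℂ) (Y : Ω → κ → ℂ) :
    secondMoment P (fun ω => c • X ω) Y = c • secondMoment P X Y := by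
  ext i k
  simp only [secondMoment, Matrix.of_apply, Matrix.smul_apply, Pi.smul_apply, smul_eq_mul,
    mul_assoc]
  exact integral_const_mul _ _

lemma secondMoment_mulVec_left {α : Type*} {X : Ω → ι → ℂ} {Y : Ω → κ → ℂ}
    (hX : HasAllMoments X P) (hY : HasAllMoments Y P) (W : Matrix α ι ℂ) :
    secondMoment P (fun ω => W *ᵥ X ω) Y = W * secondMoment P X Y := by
  ext i k
  simp only [secondMoment, Matrix.of_apply, Matrix.mul_apply, Matrix.mulVec, dotProduct,
    Finset.sum_mul, mul_assoc]
  rw [integral_finsetSum _ fun a _ => (((hX.eval a).mul (hY.eval k)).integrable.const_mul _)]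
  exact Finset.sum_congr rfl fun a _ => integral_const_mul _ _

/-- Expectation of a product of two linear forms. -/
lemma integral_dotProduct_mul_dotProduct {X : Ω → ι → ℂ} {Y : Ω → κ → ℂ}
    (hX : HasAllMoments X P) (hY : HasAllMoments Y P) (a : ι → ℂ) (b : κ → ℂ) :
    ∫ ω, (a ⬝ᵥ X ω) * (b ⬝ᵥ Y ω) ∂P = a ⬝ᵥ secondMoment P X Y *ᵥ b := by
  have h : ∀ i k, Integrable (fun ω => a i * X ω i * (b k * Y ω k)) P := fun i k => by
    refine (((hX.eval i).mul (hY.eval k)).integrable.const_mul (a i * b k)).congr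
      (ae_of_all _ fun ω => ?_)
    simp only
    ring
  simp only [dotProduct, Matrix.mulVec, Finset.sum_mul_sum]
  simp only [Finset.mul_sum]
  rw [integral_finsetSum _ fun i _ => integrable_finsetSum _ fun k _ => h i k]
  refine Finset.sum_congr rfl fun i _ => ?_
  rw [integral_finsetSum _ fun k _ => h i k]
  refine Finset.sum_congr rfl fun k _ => ?_
  rw [secondMoment, Matrix.of_apply, mul_comm _ (b k), ← mul_assoc, ← integral_const_mul]
  exact integral_congr_ae (ae_of_all _ fun ω => by simp only; ring)

lemma integral_norm_sq_star_dotProduct {M : ℕ} {X : Ω → Fin M → ℂ} (hX : HasAllMoments X P)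
    (x : Fin M → ℂ) :
    ((∫ ω, ‖star x ⬝ᵥ X ω‖ ^ 2 ∂P : ℝ) : ℂ)
      = star x ⬝ᵥ secondMoment P X (fun ω => star (X ω)) *ᵥ x := by
  rw [← integral_dotProduct_mul_dotProduct hX hX.star_comp, ← integral_complex_ofReal]
  refine integral_congr_ae (ae_of_all _ fun ω => ?_)
  simp only
  rw [Complex.ofReal_pow, ← Complex.mul_conj', starRingEnd_apply, star_star_dotProduct,
    dotProduct_comm x]

/-- A bound on the covariance matrix bounds the mean energy of a linear image. -/
lemma integral_normSq_mulVec_le {M : ℕ} {X : Ω → Fin M → ℂ} (hX : HasAllMoments X P) {r : ℝ}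
    (hr : ∀ x, ∫ ω, ‖star x ⬝ᵥ X ω‖ ^ 2 ∂P ≤ r * normSq x) [IsFiniteMeasure P]
    (B : Matrix (Fin M) (Fin M) ℂ) :
    ∫ ω, normSq (B *ᵥ X ω) ∂P ≤ r * frobeniusNorm B ^ 2 := by
  simp_rw [normSq_mulVec]
  rw [integral_finsetSum _ fun m _ =>
    (HasAllMoments.dotProduct (.const _) hX).integrable_norm_sq, frobeniusNorm_sq, Finset.mul_sum]
  exact Finset.sum_le_sum fun m _ => hr _

end SecondMoment

/-! ### Independence -/

/-- Every real-linear form on `ℂ^ι` is the real part of a complex-linear form. -/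
lemma exists_eq_re_dotProduct {ι : Type*} [Fintype ι] (f : (ι → ℂ) →L[ℝ] ℝ) :
    ∃ a : ι → ℂ, ∀ z, f z = (a ⬝ᵥ z).re := by
  classical
  refine ⟨fun i => ⟨f (Pi.single i 1), -f (Pi.single i Complex.I)⟩, fun z => ?_⟩
  have hz : z = ∑ i, ((z i).re • (Pi.single i 1 : ι → ℂ)
      + (z i).im • (Pi.single i Complex.I : ι → ℂ)) := by
    ext k
    simp only [Finset.sum_apply, Pi.add_apply, Pi.smul_apply, Pi.single_apply,
      Finset.sum_add_distrib, smul_ite, smul_zero, Finset.sum_ite_eq, Finset.mem_univ, if_true]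
    simp [Complex.re_add_im]
  conv_lhs => rw [hz]
  simp only [map_sum, map_add, map_smul, dotProduct, Complex.re_sum, Complex.mul_re, smul_eq_mul]
  exact Finset.sum_congr rfl fun i _ => by ring

/-- Jointly Gaussian complex vectors are independent as soon as their cross-covariance and their
cross-pseudo-covariance vanish. -/
lemma indepFun_of_secondMoment_eq_zero {ι κ : Type*} [Fintype ι] [Fintype κ]
    {X : Ω → ι → ℂ} {Y : Ω → κ → ℂ} (hXY : HasGaussianLaw (fun ω => (X ω, Y ω)) P)
    (hmean : ∀ i, ∫ ω, X ω i ∂P = 0) (hpseudo : secondMoment P X Y = 0)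
    (hcov : secondMoment P X (fun ω => star (Y ω)) = 0) :
    IndepFun X Y P := by
  have := hXY.isProbabilityMeasure
  have hX := hXY.fst.hasAllMoments
  have hY := hXY.snd.hasAllMoments
  refine hXY.indepFun_of_covariance_strongDual fun f g => ?_
  obtain ⟨a, ha⟩ := exists_eq_re_dotProduct f
  obtain ⟨b, hb⟩ := exists_eq_re_dotProduct g
  rw [covariance_eq_sub (hXY.fst.map f).memLp_two (hXY.snd.map g).memLp_two]
  have h0 : ∫ ω, (f ∘ X) ω ∂P = 0 := by
    have : ∫ ω, X ω ∂P = 0 := by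
      ext i
      rw [eval_integral fun i => (hX.eval i).integrable, hmean i, Pi.zero_apply]
    simp only [Function.comp_apply]
    rw [f.integral_comp_comm hX.integrable, this, map_zero]
  -- `Re p * Re q = Re (p q + p q̄) / 2`
  have h1 : ∀ ω, ((f ∘ X) * (g ∘ Y)) ω
      = ((a ⬝ᵥ X ω) * (b ⬝ᵥ Y ω) + (a ⬝ᵥ X ω) * (star b ⬝ᵥ star (Y ω))).re / 2 := by
    intro ω
    rw [Pi.mul_apply, Function.comp_apply, Function.comp_apply, ha, hb,
      Matrix.star_dotProduct_star, dotProduct_comm (Y ω) b]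
    simp
  have hI1 := (HasAllMoments.dotProduct (.const a) hX).mul (.dotProduct (.const b) hY)
  have hI2 := (HasAllMoments.dotProduct (.const a) hX).mul
    (.dotProduct (.const (star b)) hY.star_comp)
  have h2 : ∫ ω, ((f ∘ X) * (g ∘ Y)) ω ∂P = 0 := by
    simp_rw [h1]
    rw [integral_div]
    have h3 := integral_re (hI1.add hI2).integrable
    simp only [RCLike.re_eq_complex_re] at h3
    rw [h3, integral_add hI1.integrable hI2.integrable, integral_dotProduct_mul_dotProduct hX hY,
      integral_dotProduct_mul_dotProduct hX hY.star_comp, hpseudo, hcov]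
    simp
  rw [h0, h2, zero_mul, sub_zero]

/-- If the covariance of `X` is at most `r`, then `E|Yᴴ X|² ≤ r E‖Y‖²` on a product space. -/
lemma integral_prod_norm_sq_star_dotProduct_le {α β : Type*} [MeasurableSpace α]
    [MeasurableSpace β] {μ : Measure α} {ν : Measure β} [IsProbabilityMeasure μ]
    [IsProbabilityMeasure ν] {M : ℕ} {X : α → Fin M → ℂ} {Y : β → Fin M → ℂ}
    (hX : HasAllMoments X μ) (hY : HasAllMoments Y ν) {r : ℝ}
    (hr : ∀ x, ∫ a, ‖star x ⬝ᵥ X a‖ ^ 2 ∂μ ≤ r * normSq x) :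
    ∫ z, ‖star (Y z.2) ⬝ᵥ X z.1‖ ^ 2 ∂(μ.prod ν) ≤ r * ∫ b, normSq (Y b) ∂ν := by
  have hX' : HasAllMoments (fun z : α × β => X z.1) (μ.prod ν) :=
    fun p hp => (hX p hp).comp_fst ν
  have hY' : HasAllMoments (fun z : α × β => Y z.2) (μ.prod ν) :=
    fun p hp => (hY p hp).comp_snd μ
  have hI := (hY'.star_comp.dotProduct hX').integrable_norm_sq
  rw [integral_prod_symm _ hI, ← integral_const_mul]
  exact integral_mono hI.integral_prod_right (hY.integrable_normSq.const_mul r) fun b => hr (Y b)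

/-- If the covariance of `X` is at most `r` and `Y` is independent of `X`, then
`E|Yᴴ X|² ≤ r E‖Y‖²`. -/
lemma integral_norm_sq_star_dotProduct_le_of_indepFun [IsProbabilityMeasure P] {M : ℕ}
    {X Y : Ω → Fin M → ℂ} (hX : HasAllMoments X P) (hY : HasAllMoments Y P) (hind : IndepFun X Y P)
    {r : ℝ} (hr : ∀ x, ∫ ω, ‖star x ⬝ᵥ X ω‖ ^ 2 ∂P ≤ r * normSq x) :
    ∫ ω, ‖star (Y ω) ⬝ᵥ X ω‖ ^ 2 ∂P ≤ r * ∫ ω, normSq (Y ω) ∂P := by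
  have hmX := hX.aemeasurable
  have hmY := hY.aemeasurable
  have := Measure.isProbabilityMeasure_map hmX (μ := P)
  have := Measure.isProbabilityMeasure_map hmY (μ := P)
  have hnc : Continuous fun x : Fin M → ℂ => normSq x := by
    unfold normSq
    fun_prop
  have hcont : Continuous fun z : (Fin M → ℂ) × (Fin M → ℂ) => ‖star z.2 ⬝ᵥ z.1‖ ^ 2 :=
    (continuous_snd.star.dotProduct continuous_fst).norm.pow 2
  have hcx : ∀ x : Fin M → ℂ, Continuous fun z : Fin M → ℂ => ‖star x ⬝ᵥ z‖ ^ 2 := fun x =>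
    (continuous_const.dotProduct continuous_id).norm.pow 2
  have hX' : HasAllMoments (fun x => x) (P.map X) := fun p hp =>
    (memLp_map_measure_iff aestronglyMeasurable_id hmX).2 (hX p hp)
  have hY' : HasAllMoments (fun x => x) (P.map Y) := fun p hp =>
    (memLp_map_measure_iff aestronglyMeasurable_id hmY).2 (hY p hp)
  have h := integral_prod_norm_sq_star_dotProduct_le hX' hY' (r := r) fun x => by
    rw [integral_map hmX (hcx x).aestronglyMeasurable]
    exact hr x
  rw [← (indepFun_iff_map_prod_eq_prod_map_map hmX hmY).1 hind,
    integral_map (hmX.prodMk hmY) hcont.aestronglyMeasurable,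
    integral_map hmY hnc.aestronglyMeasurable] at h
  exact h

/-! ### The variance of a Gaussian quadratic form -/

/-- The variance of `f` is at most half the mean square of the difference of two independent
copies. -/
lemma integral_norm_sub_integral_sq_le {α : Type*} [MeasurableSpace α] {μ : Measure α}
    [IsProbabilityMeasure μ] {f : α → ℂ} (hf : HasAllMoments f μ) :
    2 * ∫ a, ‖f a - ∫ b, f b ∂μ‖ ^ 2 ∂μ ≤ ∫ z, ‖f z.1 - f z.2‖ ^ 2 ∂(μ.prod μ) := by
  set e := ∫ b, f b ∂μ with he
  set g : α → ℂ := fun a => f a - e with hg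
  have hgm : HasAllMoments g μ := hf.sub (.const e)
  have hg0 : ∫ a, g a ∂μ = 0 := by
    rw [hg, integral_sub hf.integrable (integrable_const e), integral_const]
    simp [he]
  have h1 : HasAllMoments (fun z : α × α => g z.1) (μ.prod μ) := fun p hp => (hgm p hp).comp_fst μ
  have h2 : HasAllMoments (fun z : α × α => g z.2) (μ.prod μ) := fun p hp => (hgm p hp).comp_snd μ
  have h3 := h1.mul h2.star_comp
  have hcross : ∫ z, (g z.1 * star (g z.2)).re ∂(μ.prod μ) = 0 := by
    have h4 := integral_re h3.integrable
    simp only [RCLike.re_eq_complex_re] at h4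
    rw [h4, integral_prod_mul g (fun a => star (g a)), hg0, zero_mul, Complex.zero_re]
  have hexp : ∀ z : α × α, ‖f z.1 - f z.2‖ ^ 2
      = ‖g z.1‖ ^ 2 + ‖g z.2‖ ^ 2 - 2 * (g z.1 * star (g z.2)).re := by
    intro z
    have : f z.1 - f z.2 = g z.1 - g z.2 := by simp [hg]
    rw [this, Complex.sq_norm, Complex.sq_norm, Complex.sq_norm, Complex.normSq_sub]
    rfl
  simp_rw [hexp]
  rw [integral_sub (by exact h1.integrable_norm_sq.add h2.integrable_norm_sq)
      (Integrable.const_mul (f := fun z : α × α => (g z.1 * star (g z.2)).re) h3.integrable.re 2),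
    integral_add h1.integrable_norm_sq h2.integrable_norm_sq, integral_const_mul, hcross,
    integral_fun_fst (fun a => ‖g a‖ ^ 2), integral_fun_snd (fun a => ‖g a‖ ^ 2)]
  simp only [probReal_univ, one_smul, mul_zero, sub_zero]
  exact (two_mul _).le

/-- Decoupling: for a centred Gaussian vector `Y` and an independent copy `Y'`, the difference of
`Yᴴ C Y` and `Y'ᴴ C Y'` has, by rotation invariance, the law of `Yᴴ C Y' + Y'ᴴ C Y`. Hence second
moments alone bound the variance of the quadratic form. -/
lemma variance_quadraticForm_le {M : ℕ} {Y : Ω → Fin M → ℂ} (hY : HasGaussianLaw Y P)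
    (hmean : ∀ m, ∫ ω, Y ω m ∂P = 0) (C : Matrix (Fin M) (Fin M) ℂ) {q s : ℝ} (hq0 : 0 ≤ q)
    (hq : ∀ x, ∫ ω, ‖star x ⬝ᵥ Y ω‖ ^ 2 ∂P ≤ q * normSq x)
    (hs : ∫ ω, normSq (C *ᵥ Y ω) ∂P ≤ s) :
    ∫ ω, ‖star (Y ω) ⬝ᵥ C *ᵥ Y ω - ∫ ω', star (Y ω') ⬝ᵥ C *ᵥ Y ω' ∂P‖ ^ 2 ∂P ≤ 2 * q * s := by
  have hmY := hY.aemeasurable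
  set μ := P.map Y with hμ
  have : IsGaussian μ := hY.isGaussian_map
  set f : (Fin M → ℂ) → ℂ := fun y => star y ⬝ᵥ C *ᵥ y with hf
  have hfc : Continuous f :=
    continuous_star.dotProduct (continuous_const.matrix_mulVec continuous_id)
  have hid : HasAllMoments (fun y => y) μ := fun p hp => IsGaussian.memLp_id μ p hp
  have hfm : HasAllMoments f μ := hid.star_comp.dotProduct (hid.mulVec C)
  have hnc : Continuous fun x : Fin M → ℂ => normSq (C *ᵥ x) := by
    unfold normSq Matrix.mulVec dotProduct
    fun_prop
  have hcx : ∀ x : Fin M → ℂ, Continuous fun z : Fin M → ℂ => ‖star x ⬝ᵥ z‖ ^ 2 := fun x =>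
    (continuous_const.dotProduct continuous_id).norm.pow 2
  have hq' : ∀ x, ∫ y, ‖star x ⬝ᵥ y‖ ^ 2 ∂μ ≤ q * normSq x := fun x => by
    rw [hμ, integral_map hmY (hcx x).aestronglyMeasurable]
    exact hq x
  have hs' : ∫ y, normSq (C *ᵥ y) ∂μ ≤ s := by
    rw [hμ, integral_map hmY hnc.aestronglyMeasurable]
    exact hs
  have hcentred : ∫ y, id y ∂μ = 0 := by
    simp only [id_eq]
    ext m
    rw [eval_integral fun i => (hid.eval i).integrable, hμ,
      integral_map hmY (continuous_apply m).aestronglyMeasurable, hmean m, Pi.zero_apply]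
  have hrot := IsGaussian.map_rotation_eq_self hcentred (Real.pi / 4)
  have h1 : HasAllMoments (fun z : (Fin M → ℂ) × (Fin M → ℂ) => z.1) (μ.prod μ) :=
    fun p hp => (hid p hp).comp_fst μ
  have h2 : HasAllMoments (fun z : (Fin M → ℂ) × (Fin M → ℂ) => z.2) (μ.prod μ) :=
    fun p hp => (hid p hp).comp_snd μ
  have hI1 := (h1.star_comp.dotProduct (h2.mulVec C)).integrable_norm_sq
  have hI2 := (h2.star_comp.dotProduct (h1.mulVec C)).integrable_norm_sq
  have hb1 : ∫ z, ‖star z.1 ⬝ᵥ C *ᵥ z.2‖ ^ 2 ∂(μ.prod μ) ≤ q * s := by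
    simp_rw [norm_star_dotProduct_comm _ (C *ᵥ _)]
    exact (integral_prod_norm_sq_star_dotProduct_le hid (hid.mulVec C) hq').trans (by gcongr)
  have hb2 : ∫ z, ‖star z.2 ⬝ᵥ C *ᵥ z.1‖ ^ 2 ∂(μ.prod μ) ≤ q * s := by
    rw [← integral_prod_swap] at hb1
    exact hb1
  have hdec : ∫ z, ‖f z.1 - f z.2‖ ^ 2 ∂(μ.prod μ) ≤ 4 * (q * s) := by
    have hFc : Continuous fun z : (Fin M → ℂ) × (Fin M → ℂ) => ‖f z.1 - f z.2‖ ^ 2 := by fun_prop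
    rw [← hrot, integral_map (by fun_prop) hFc.aestronglyMeasurable]
    have hcalc : ∀ z : (Fin M → ℂ) × (Fin M → ℂ),
        ‖f (ContinuousLinearMap.rotation (Real.pi / 4) z).1
          - f (ContinuousLinearMap.rotation (Real.pi / 4) z).2‖ ^ 2
        ≤ 2 * ‖star z.1 ⬝ᵥ C *ᵥ z.2‖ ^ 2 + 2 * ‖star z.2 ⬝ᵥ C *ᵥ z.1‖ ^ 2 := by
      rintro ⟨a, b⟩
      have hc : ((Real.sqrt 2 / 2 : ℝ) : ℂ) * ((Real.sqrt 2 / 2 : ℝ) : ℂ) = 1 / 2 := by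
        rw [← Complex.ofReal_mul, div_mul_div_comm, Real.mul_self_sqrt (by norm_num)]
        norm_num
      have heq : f (ContinuousLinearMap.rotation (Real.pi / 4) (a, b)).1
          - f (ContinuousLinearMap.rotation (Real.pi / 4) (a, b)).2
          = star a ⬝ᵥ C *ᵥ b + star b ⬝ᵥ C *ᵥ a := by
        simp only [ContinuousLinearMap.rotation_apply, Real.cos_pi_div_four,
          Real.sin_pi_div_four, hf]
        have hsm : ∀ (t : ℝ) (v : Fin M → ℂ), t • v = (t : ℂ) • v := fun t v => by
          ext
          simp
        simp only [hsm, star_add, star_smul, Matrix.mulVec_add, Matrix.mulVec_smul,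
          add_dotProduct, dotProduct_add, smul_dotProduct, dotProduct_smul, smul_eq_mul]
        have hst : ∀ t : ℝ, star (t : ℂ) = t := Complex.conj_ofReal
        simp only [Complex.ofReal_neg, star_neg, hst]
        linear_combination (2 * (star a ⬝ᵥ C *ᵥ b) + 2 * (star b ⬝ᵥ C *ᵥ a)) * hc
      rw [heq]
      have := norm_add_le (star a ⬝ᵥ C *ᵥ b) (star b ⬝ᵥ C *ᵥ a)
      have h0 := norm_nonneg (star a ⬝ᵥ C *ᵥ b + star b ⬝ᵥ C *ᵥ a)
      simp only
      nlinarith [sq_nonneg (‖star a ⬝ᵥ C *ᵥ b‖ - ‖star b ⬝ᵥ C *ᵥ a‖)]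
    refine (integral_mono_of_nonneg (ae_of_all _ fun z => by positivity)
      ((hI1.const_mul 2).add (hI2.const_mul 2)) (ae_of_all _ hcalc)).trans ?_
    simp only [Pi.add_apply]
    rw [integral_add (hI1.const_mul 2) (hI2.const_mul 2), integral_const_mul, integral_const_mul]
    linarith
  have hvar := integral_norm_sub_integral_sq_le hfm
  have hmap : ∫ y, ‖f y - ∫ y', f y' ∂μ‖ ^ 2 ∂μ
      = ∫ ω, ‖f (Y ω) - ∫ ω', f (Y ω') ∂P‖ ^ 2 ∂P := by
    rw [hμ, integral_map hmY (by fun_prop), integral_map hmY hfc.aestronglyMeasurable]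
  rw [hmap] at hvar
  simp only [hf] at hvar hdec
  linarith

end Moments

/-! ### Second-order statistics of the channel model -/

section Model

variable {Ω : Type*} [MeasurableSpace Ω] {P : Measure Ω}

lemma conjTranspose_secondMoment {ι κ : Type*} (X : Ω → ι → ℂ) (Y : Ω → κ → ℂ) :
    (secondMoment P Y (fun ω => star (X ω)))ᴴ = secondMoment P X (fun ω => star (Y ω)) := by
  rw [← transpose_secondMoment (fun ω => star (Y ω)) X, Matrix.conjTranspose,
    Matrix.transpose_map, ← secondMoment_star]
  simp only [star_star]

lemma secondMoment_eq_zero_of_indepFun {ι κ : Type*} [Fintype ι] [Fintype κ]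
    {X : Ω → ι → ℂ} {Y : Ω → κ → ℂ} (hX : HasAllMoments X P) (hY : HasAllMoments Y P)
    (h : IndepFun X Y P) (hmean : ∀ i, ∫ ω, X ω i ∂P = 0) :
    secondMoment P X Y = 0 ∧ secondMoment P X (fun ω => star (Y ω)) = 0 := by
  constructor
  · ext i k
    have h' : IndepFun (fun ω => X ω i) (fun ω => Y ω k) P :=
      h.comp (measurable_pi_apply i) (measurable_pi_apply k)
    rw [secondMoment, Matrix.of_apply, h'.integral_fun_mul_eq_mul_integral
      (hX.eval i).integrable.aestronglyMeasurable (hY.eval k).integrable.aestronglyMeasurable,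
      hmean i, zero_mul, Matrix.zero_apply]
  · ext i k
    have h' : IndepFun (fun ω => X ω i) (fun ω => star (Y ω k)) P :=
      h.comp (measurable_pi_apply i) (continuous_star.measurable.comp (measurable_pi_apply k))
    rw [secondMoment, Matrix.of_apply]
    refine (h'.integral_fun_mul_eq_mul_integral (hX.eval i).integrable.aestronglyMeasurable
      (hY.eval k).star_comp.integrable.aestronglyMeasurable).trans ?_
    rw [hmean i, zero_mul, Matrix.zero_apply]

namespace IsCN

variable {M : ℕ} {X : Ω → Fin M → ℂ} {R : Matrix (Fin M) (Fin M) ℂ}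

lemma hasAllMoments (h : IsCN X R P) : HasAllMoments X P := h.gaussian.hasAllMoments

lemma secondMoment_star_self (h : IsCN X R P) : secondMoment P X (fun ω => star (X ω)) = R := by
  ext m n
  exact h.covariance m n

lemma secondMoment_self (h : IsCN X R P) : secondMoment P X X = 0 := by
  ext m n
  exact h.pseudoCovariance m n

lemma isHermitian (h : IsCN X R P) : R.IsHermitian := by
  rw [Matrix.IsHermitian, ← h.secondMoment_star_self, conjTranspose_secondMoment]

end IsCN

/-- The covariance matrix of a random vector defines a nonnegative quadratic form. -/
lemma re_star_dotProduct_secondMoment {M : ℕ} {X : Ω → Fin M → ℂ} (hX : HasAllMoments X P)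
    (x : Fin M → ℂ) :
    (star x ⬝ᵥ secondMoment P X (fun ω => star (X ω)) *ᵥ x).re = ∫ ω, ‖star x ⬝ᵥ X ω‖ ^ 2 ∂P := by
  rw [← integral_norm_sq_star_dotProduct hX, Complex.ofReal_re]

variable {L K M : ℕ} {R : Fin L → Fin L → Fin K → Matrix (Fin M) (Fin M) ℂ}
  {h : Fin L → Fin L → Fin K → Ω → Fin M → ℂ} {n : Fin L → Fin K → Ω → Fin M → ℂ} {ρtr ρul : ℝ}

/-- The pilot observation `y_{ji} = ∑_l h_{jli} + n_{ji} / √ρtr`. -/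
def pilotObs (ρtr : ℝ) (h : Fin L → Fin L → Fin K → Ω → Fin M → ℂ)
    (n : Fin L → Fin K → Ω → Fin M → ℂ) (j : Fin L) (i : Fin K) (ω : Ω) : Fin M → ℂ :=
  ∑ l, h j l i ω + ((1 / Real.sqrt ρtr : ℝ) : ℂ) • n j i ω

/-- The filter `R_{jli} Q_{ji}⁻¹` that turns the pilot observation into the channel estimate. -/
def estMatrix (ρtr : ℝ) (R : Fin L → Fin L → Fin K → Matrix (Fin M) (Fin M) ℂ) (j l : Fin L)
    (i : Fin K) : Matrix (Fin M) (Fin M) ℂ :=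
  R j l i * (pilotCov ρtr R j i)⁻¹

/-- The estimation error `h_{jli} - ĥ_{jli}`. -/
def estErr (ρtr : ℝ) (R : Fin L → Fin L → Fin K → Matrix (Fin M) (Fin M) ℂ)
    (h : Fin L → Fin L → Fin K → Ω → Fin M → ℂ) (n : Fin L → Fin K → Ω → Fin M → ℂ)
    (j l : Fin L) (i : Fin K) (ω : Ω) : Fin M → ℂ :=
  h j l i ω - channelEst ρtr R h n j l i ω

omit [MeasurableSpace Ω] in
lemma channelEst_eq (j l : Fin L) (i : Fin K) (ω : Ω) :
    channelEst ρtr R h n j l i ω = estMatrix ρtr R j l i *ᵥ pilotObs ρtr h n j i ω := rfl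

/-- All channels and noise vectors at base station `j`, as one random vector. -/
def jointVec (h : Fin L → Fin L → Fin K → Ω → Fin M → ℂ) (n : Fin L → Fin K → Ω → Fin M → ℂ)
    (j : Fin L) (ω : Ω) : (Fin L × Fin K) ⊕ Fin K → Fin M → ℂ :=
  fun s => Sum.elim (fun q : Fin L × Fin K => h j q.1 q.2) (fun i : Fin K => n j i) s ω

/-- The real-linear map that sends the channels and noise vectors to the `i`-th pilot
observation. -/
def pilotCLM (L M : ℕ) (ρtr : ℝ) (i : Fin K) :
    ((Fin L × Fin K) ⊕ Fin K → Fin M → ℂ) →L[ℝ] (Fin M → ℂ) :=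
  ∑ l : Fin L, ContinuousLinearMap.proj (Sum.inl (l, i))
    + (1 / Real.sqrt ρtr) • ContinuousLinearMap.proj (Sum.inr i)

omit [MeasurableSpace Ω] in
lemma pilotObs_eq_pilotCLM (j : Fin L) (i : Fin K) (ω : Ω) :
    pilotObs ρtr h n j i ω = pilotCLM L M ρtr i (jointVec h n j ω) := by
  ext m
  simp [pilotObs, pilotCLM, jointVec]

namespace IsChannelModel

variable (hm : IsChannelModel P R h n)
include hm

lemma secondMoment_channel_channel {j l l' : Fin L} {i i' : Fin K} (hne : (l, i) ≠ (l', i')) :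
    secondMoment P (h j l i) (h j l' i') = 0 ∧
      secondMoment P (h j l i) (fun ω => star (h j l' i' ω)) = 0 :=
  secondMoment_eq_zero_of_indepFun (hm.channel j l i).hasAllMoments
    (hm.channel j l' i').hasAllMoments
    ((hm.indep j).indepFun (i := Sum.inl (l, i)) (j := Sum.inl (l', i')) (by simpa using hne))
    (hm.channel j l i).mean

lemma secondMoment_noise_channel (j l : Fin L) (i i' : Fin K) :
    secondMoment P (n j i) (h j l i') = 0 ∧
      secondMoment P (n j i) (fun ω => star (h j l i' ω)) = 0 :=
  secondMoment_eq_zero_of_indepFun (hm.noise j i).hasAllMoments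
    (hm.channel j l i').hasAllMoments
    ((hm.indep j).indepFun (i := Sum.inr i) (j := Sum.inl (l, i')) (by simp))
    (hm.noise j i).mean

lemma secondMoment_channel_noise (j l : Fin L) (i i' : Fin K) :
    secondMoment P (h j l i) (n j i') = 0 ∧
      secondMoment P (h j l i) (fun ω => star (n j i' ω)) = 0 :=
  secondMoment_eq_zero_of_indepFun (hm.channel j l i).hasAllMoments
    (hm.noise j i').hasAllMoments
    ((hm.indep j).indepFun (i := Sum.inl (l, i)) (j := Sum.inr i') (by simp))
    (hm.channel j l i).mean

lemma secondMoment_noise_noise {j : Fin L} {i i' : Fin K} (hne : i ≠ i') :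
    secondMoment P (n j i) (n j i') = 0 ∧
      secondMoment P (n j i) (fun ω => star (n j i' ω)) = 0 :=
  secondMoment_eq_zero_of_indepFun (hm.noise j i).hasAllMoments
    (hm.noise j i').hasAllMoments
    ((hm.indep j).indepFun (i := Sum.inr i) (j := Sum.inr i') (by simpa using hne))
    (hm.noise j i).mean

variable [IsProbabilityMeasure P]

lemma hasAllMoments_pilotObs (j : Fin L) (i : Fin K) : HasAllMoments (pilotObs ρtr h n j i) P :=
  .add (.sum fun l _ => (hm.channel j l i).hasAllMoments) ((hm.noise j i).hasAllMoments.smul _)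

lemma hasAllMoments_channelEst (j l : Fin L) (i : Fin K) :
    HasAllMoments (channelEst ρtr R h n j l i) P :=
  (hm.hasAllMoments_pilotObs j i).mulVec _

lemma hasAllMoments_estErr (j l : Fin L) (i : Fin K) :
    HasAllMoments (estErr ρtr R h n j l i) P :=
  (hm.channel j l i).hasAllMoments.sub (hm.hasAllMoments_channelEst j l i)

lemma secondMoment_pilotObs_left {κ : Type*} [Fintype κ] {X : Ω → κ → ℂ}
    (hX : HasAllMoments X P) (j : Fin L) (i : Fin K) :
    secondMoment P (pilotObs ρtr h n j i) X = ∑ l, secondMoment P (h j l i) X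
      + ((1 / Real.sqrt ρtr : ℝ) : ℂ) • secondMoment P (n j i) X := by
  rw [← secondMoment_smul_left, ← secondMoment_sum_left
    (fun l _ => (hm.channel j l i).hasAllMoments) hX, ← secondMoment_add_left
    (.sum fun l _ => (hm.channel j l i).hasAllMoments) ((hm.noise j i).hasAllMoments.smul _) hX]
  rfl

lemma secondMoment_pilotObs_channel (j l : Fin L) (i i' : Fin K) :
    secondMoment P (pilotObs ρtr h n j i) (h j l i') = 0 := by
  rw [hm.secondMoment_pilotObs_left (hm.channel j l i').hasAllMoments,
    (hm.secondMoment_noise_channel j l i i').1, smul_zero, add_zero]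
  refine Finset.sum_eq_zero fun l' _ => ?_
  by_cases hne : (l', i) = (l, i')
  · cases hne
    exact (hm.channel j l i).secondMoment_self
  · exact (hm.secondMoment_channel_channel hne).1

lemma secondMoment_pilotObs_star_channel (j l : Fin L) (i i' : Fin K) :
    secondMoment P (pilotObs ρtr h n j i) (fun ω => star (h j l i' ω))
      = if i = i' then R j l i else 0 := by
  rw [hm.secondMoment_pilotObs_left (hm.channel j l i').hasAllMoments.star_comp,
    (hm.secondMoment_noise_channel j l i i').2, smul_zero, add_zero, Finset.sum_eq_single l]
  · split_ifs with hi
    · subst hi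
      exact (hm.channel j l i).secondMoment_star_self
    · exact (hm.secondMoment_channel_channel (by simp [hi])).2
  · intro l' _ hl'
    exact (hm.secondMoment_channel_channel (by simp [hl'])).2
  · simp

lemma secondMoment_channel_pilotObs (j l : Fin L) (i i' : Fin K) :
    secondMoment P (h j l i) (pilotObs ρtr h n j i') = 0 := by
  rw [← transpose_secondMoment, hm.secondMoment_pilotObs_channel, Matrix.transpose_zero]

lemma secondMoment_channel_star_pilotObs (j l : Fin L) (i i' : Fin K) :
    secondMoment P (h j l i) (fun ω => star (pilotObs ρtr h n j i' ω))
      = if i = i' then R j l i else 0 := by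
  rw [← conjTranspose_secondMoment, hm.secondMoment_pilotObs_star_channel]
  by_cases hi : i = i'
  · subst hi
    simp [(hm.channel j l i).isHermitian.eq]
  · simp [hi, Ne.symm hi]

lemma secondMoment_pilotObs_noise (j : Fin L) (i i' : Fin K) :
    secondMoment P (pilotObs ρtr h n j i) (n j i') = 0 := by
  rw [hm.secondMoment_pilotObs_left (hm.noise j i').hasAllMoments,
    Finset.sum_eq_zero fun l _ => (hm.secondMoment_channel_noise j l i i').1, zero_add]
  by_cases hi : i = i'
  · subst hi
    rw [(hm.noise j i).secondMoment_self, smul_zero]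
  · rw [(hm.secondMoment_noise_noise hi).1, smul_zero]

lemma secondMoment_pilotObs_star_noise (j : Fin L) (i i' : Fin K) :
    secondMoment P (pilotObs ρtr h n j i) (fun ω => star (n j i' ω))
      = if i = i' then ((1 / Real.sqrt ρtr : ℝ) : ℂ) • 1 else 0 := by
  rw [hm.secondMoment_pilotObs_left (hm.noise j i').hasAllMoments.star_comp,
    Finset.sum_eq_zero fun l _ => (hm.secondMoment_channel_noise j l i i').2, zero_add]
  split_ifs with hi
  · subst hi
    rw [(hm.noise j i).secondMoment_star_self]
  · rw [(hm.secondMoment_noise_noise hi).2, smul_zero]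

lemma secondMoment_pilotObs_pilotObs (j : Fin L) (i i' : Fin K) :
    secondMoment P (pilotObs ρtr h n j i) (pilotObs ρtr h n j i') = 0 := by
  rw [hm.secondMoment_pilotObs_left (hm.hasAllMoments_pilotObs j i'),
    Finset.sum_eq_zero fun l _ => hm.secondMoment_channel_pilotObs j l i i',
    ← transpose_secondMoment, hm.secondMoment_pilotObs_noise]
  simp

lemma secondMoment_pilotObs_star_pilotObs (hρtr : 0 < ρtr) (j : Fin L) (i i' : Fin K) :
    secondMoment P (pilotObs ρtr h n j i) (fun ω => star (pilotObs ρtr h n j i' ω))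
      = if i = i' then pilotCov ρtr R j i else 0 := by
  rw [hm.secondMoment_pilotObs_left (hm.hasAllMoments_pilotObs j i').star_comp,
    Finset.sum_congr rfl fun l _ => hm.secondMoment_channel_star_pilotObs j l i i',
    ← conjTranspose_secondMoment, hm.secondMoment_pilotObs_star_noise]
  by_cases hi : i = i'
  · subst hi
    have hc : ((1 / Real.sqrt ρtr : ℝ) : ℂ) * ((1 / Real.sqrt ρtr : ℝ) : ℂ)
        = ((1 / ρtr : ℝ) : ℂ) := by
      rw [← Complex.ofReal_mul, div_mul_div_comm, Real.mul_self_sqrt hρtr.le, one_mul]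
    simp only [if_true, Matrix.conjTranspose_smul, Matrix.conjTranspose_one, smul_smul]
    rw [← starRingEnd_apply, Complex.conj_ofReal, hc, pilotCov]
  · simp [hi, Ne.symm hi]

omit [IsProbabilityMeasure P] in
lemma re_star_dotProduct_mulVec_nonneg (j l : Fin L) (i : Fin K) (x : Fin M → ℂ) :
    0 ≤ (star x ⬝ᵥ R j l i *ᵥ x).re := by
  rw [← (hm.channel j l i).secondMoment_star_self,
    re_star_dotProduct_secondMoment (hm.channel j l i).hasAllMoments]
  positivity

omit [IsProbabilityMeasure P] in
lemma isUnit_pilotCov (hρtr : 0 < ρtr) (j : Fin L) (i : Fin K) :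
    IsUnit (pilotCov ρtr R j i) := by
  refine isUnit_of_coercive (z := 1 / ρtr) (by positivity) fun x => ?_
  rw [pilotCov, Matrix.add_mulVec, dotProduct_add, Matrix.sum_mulVec, dotProduct_sum,
    Matrix.smul_mulVec, Matrix.one_mulVec, dotProduct_smul, star_dotProduct_self, Complex.add_re,
    Complex.re_sum, smul_eq_mul, Complex.re_ofReal_mul, Complex.ofReal_re]
  have := Finset.sum_nonneg fun l (_ : l ∈ Finset.univ) =>
    hm.re_star_dotProduct_mulVec_nonneg j l i x
  linarith

omit [IsProbabilityMeasure P] in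
lemma estMatrix_mul_pilotCov (hρtr : 0 < ρtr) (j l : Fin L) (i : Fin K) :
    estMatrix ρtr R j l i * pilotCov ρtr R j i = R j l i := by
  rw [estMatrix, Matrix.mul_assoc, Matrix.nonsing_inv_mul _
    ((Matrix.isUnit_iff_isUnit_det _).1 (hm.isUnit_pilotCov hρtr j i)), Matrix.mul_one]

lemma secondMoment_estErr_pilotObs (j l : Fin L) (i i' : Fin K) :
    secondMoment P (estErr ρtr R h n j l i) (pilotObs ρtr h n j i') = 0 := by
  have hy := hm.hasAllMoments_pilotObs (ρtr := ρtr) j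
  refine (secondMoment_sub_left (hm.channel j l i).hasAllMoments
    (hm.hasAllMoments_channelEst j l i) (hy i')).trans ?_
  rw [hm.secondMoment_channel_pilotObs, zero_sub, neg_eq_zero]
  refine (secondMoment_mulVec_left (hy i) (hy i') _).trans ?_
  rw [hm.secondMoment_pilotObs_pilotObs, mul_zero]

/-- The orthogonality principle for the MMSE estimate. -/
lemma secondMoment_estErr_star_pilotObs (hρtr : 0 < ρtr) (j l : Fin L) (i i' : Fin K) :
    secondMoment P (estErr ρtr R h n j l i) (fun ω => star (pilotObs ρtr h n j i' ω)) = 0 := by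
  have hy := hm.hasAllMoments_pilotObs (ρtr := ρtr) j
  refine (secondMoment_sub_left (hm.channel j l i).hasAllMoments
    (hm.hasAllMoments_channelEst j l i) (hy i').star_comp).trans ?_
  rw [hm.secondMoment_channel_star_pilotObs, sub_eq_zero]
  refine ((secondMoment_mulVec_left (hy i) (hy i').star_comp _).trans ?_).symm
  rw [hm.secondMoment_pilotObs_star_pilotObs hρtr]
  split_ifs with hi
  · exact hm.estMatrix_mul_pilotCov hρtr j l i
  · exact mul_zero _

lemma secondMoment_channelEst_star (hρtr : 0 < ρtr) (j l : Fin L) (i : Fin K) :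
    secondMoment P (channelEst ρtr R h n j l i) (fun ω => star (channelEst ρtr R h n j l i ω))
      = estCov ρtr R j l i := by
  have hy := hm.hasAllMoments_pilotObs (ρtr := ρtr) j i
  refine (secondMoment_mulVec_left hy (hm.hasAllMoments_channelEst j l i).star_comp _).trans ?_
  rw [← conjTranspose_secondMoment]
  have h1 : secondMoment P (channelEst ρtr R h n j l i)
      (fun ω => star (pilotObs ρtr h n j i ω)) = R j l i := by
    refine (secondMoment_mulVec_left hy hy.star_comp _).trans ?_
    rw [hm.secondMoment_pilotObs_star_pilotObs hρtr, if_pos rfl]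
    exact hm.estMatrix_mul_pilotCov hρtr j l i
  rw [h1, (hm.channel j l i).isHermitian.eq]
  rfl

lemma secondMoment_estErr_star (hρtr : 0 < ρtr) (j l : Fin L) (i : Fin K) :
    secondMoment P (estErr ρtr R h n j l i) (fun ω => star (estErr ρtr R h n j l i ω))
      = R j l i - estCov ρtr R j l i := by
  have hy := hm.hasAllMoments_pilotObs (ρtr := ρtr) j i
  have he := hm.hasAllMoments_estErr (ρtr := ρtr) j l i
  have hh := (hm.channel j l i).hasAllMoments
  -- The error is orthogonal to the estimate, so only its correlation with the channel is left.
  have h1 : secondMoment P (estErr ρtr R h n j l i) (fun ω => star (estErr ρtr R h n j l i ω))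
      = secondMoment P (h j l i) (fun ω => star (estErr ρtr R h n j l i ω)) := by
    refine (secondMoment_sub_left hh (hm.hasAllMoments_channelEst j l i) he.star_comp).trans ?_
    rw [sub_eq_self]
    refine (secondMoment_mulVec_left hy he.star_comp _).trans ?_
    rw [← conjTranspose_secondMoment, hm.secondMoment_estErr_star_pilotObs hρtr,
      Matrix.conjTranspose_zero, mul_zero]
  have h2 : secondMoment P (estErr ρtr R h n j l i) (fun ω => star (h j l i ω))
      = R j l i - estCov ρtr R j l i := by
    refine (secondMoment_sub_left hh (hm.hasAllMoments_channelEst j l i) hh.star_comp).trans ?_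
    rw [(hm.channel j l i).secondMoment_star_self]
    congr 1
    refine (secondMoment_mulVec_left hy hh.star_comp _).trans ?_
    rw [hm.secondMoment_pilotObs_star_channel, if_pos rfl]
    rfl
  rw [← conjTranspose_secondMoment, h1, conjTranspose_secondMoment, h2]

lemma integral_norm_sq_channelEst_add (hρtr : 0 < ρtr) (j l : Fin L) (i : Fin K)
    (x : Fin M → ℂ) :
    ∫ ω, ‖star x ⬝ᵥ channelEst ρtr R h n j l i ω‖ ^ 2 ∂P
      + ∫ ω, ‖star x ⬝ᵥ estErr ρtr R h n j l i ω‖ ^ 2 ∂P = (star x ⬝ᵥ R j l i *ᵥ x).re := by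
  rw [← re_star_dotProduct_secondMoment (hm.hasAllMoments_channelEst j l i),
    ← re_star_dotProduct_secondMoment (hm.hasAllMoments_estErr j l i),
    hm.secondMoment_channelEst_star hρtr, hm.secondMoment_estErr_star hρtr, Matrix.sub_mulVec,
    dotProduct_sub, Complex.sub_re]
  ring

lemma integral_norm_sq_channelEst_le (hρtr : 0 < ρtr) {j l : Fin L} {i : Fin K} {r : ℝ}
    (hr : specNorm (R j l i) ≤ r) (x : Fin M → ℂ) :
    ∫ ω, ‖star x ⬝ᵥ channelEst ρtr R h n j l i ω‖ ^ 2 ∂P ≤ r * normSq x := by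
  have h1 := hm.integral_norm_sq_channelEst_add hρtr j l i x
  have h2 : 0 ≤ ∫ ω, ‖star x ⬝ᵥ estErr ρtr R h n j l i ω‖ ^ 2 ∂P := by positivity
  have h3 := re_star_dotProduct_mulVec_le (R j l i) x
  have h4 := mul_le_mul_of_nonneg_right hr (normSq_nonneg x)
  linarith

lemma integral_norm_sq_estErr_le (hρtr : 0 < ρtr) {j l : Fin L} {i : Fin K} {r : ℝ}
    (hr : specNorm (R j l i) ≤ r) (x : Fin M → ℂ) :
    ∫ ω, ‖star x ⬝ᵥ estErr ρtr R h n j l i ω‖ ^ 2 ∂P ≤ r * normSq x := by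
  have h1 := hm.integral_norm_sq_channelEst_add hρtr j l i x
  have h2 : 0 ≤ ∫ ω, ‖star x ⬝ᵥ channelEst ρtr R h n j l i ω‖ ^ 2 ∂P := by positivity
  have h3 := re_star_dotProduct_mulVec_le (R j l i) x
  have h4 := mul_le_mul_of_nonneg_right hr (normSq_nonneg x)
  linarith

lemma integral_norm_sq_pilotObs_le (hρtr : 0 < ρtr) {j : Fin L} {i : Fin K} {r : ℝ}
    (hr : ∀ l, specNorm (R j l i) ≤ r) (x : Fin M → ℂ) :
    ∫ ω, ‖star x ⬝ᵥ pilotObs ρtr h n j i ω‖ ^ 2 ∂P ≤ (L * r + 1 / ρtr) * normSq x := by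
  rw [← re_star_dotProduct_secondMoment (hm.hasAllMoments_pilotObs j i),
    hm.secondMoment_pilotObs_star_pilotObs hρtr, if_pos rfl, pilotCov, Matrix.add_mulVec,
    dotProduct_add, Matrix.sum_mulVec, dotProduct_sum, Matrix.smul_mulVec, Matrix.one_mulVec,
    dotProduct_smul, star_dotProduct_self, Complex.add_re, Complex.re_sum, smul_eq_mul,
    Complex.re_ofReal_mul, Complex.ofReal_re, add_mul]
  gcongr
  have h1 : ∀ l ∈ Finset.univ, (star x ⬝ᵥ R j l i *ᵥ x).re ≤ r * normSq x := fun l _ =>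
    (re_star_dotProduct_mulVec_le _ x).trans
      (mul_le_mul_of_nonneg_right (hr l) (normSq_nonneg x))
  refine (Finset.sum_le_card_nsmul _ _ _ h1).trans_eq ?_
  simp [mul_assoc]

omit [IsProbabilityMeasure P] hm in
lemma re_errCov (j : Fin L) (x : Fin M → ℂ) :
    (star x ⬝ᵥ errCov ρtr ρul R j *ᵥ x).re
      = ∑ l, ∑ i, (star x ⬝ᵥ (R j l i - estCov ρtr R j l i) *ᵥ x).re + 1 / ρul * normSq x := by
  rw [errCov, Matrix.add_mulVec, dotProduct_add, Matrix.sum_mulVec, dotProduct_sum,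
    Matrix.smul_mulVec, Matrix.one_mulVec, dotProduct_smul, star_dotProduct_self, Complex.add_re,
    Complex.re_sum, smul_eq_mul, Complex.re_ofReal_mul, Complex.ofReal_re]
  congr 1
  refine Finset.sum_congr rfl fun l _ => ?_
  rw [Matrix.sum_mulVec, dotProduct_sum, Complex.re_sum]

lemma isHermitian_errCov (hρtr : 0 < ρtr) (j : Fin L) : (errCov ρtr ρul R j).IsHermitian := by
  rw [Matrix.IsHermitian, errCov, Matrix.conjTranspose_add, Matrix.conjTranspose_sum,
    Matrix.conjTranspose_smul, Matrix.conjTranspose_one, ← starRingEnd_apply,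
    Complex.conj_ofReal]
  congr 1
  refine Finset.sum_congr rfl fun l _ => ?_
  rw [Matrix.conjTranspose_sum]
  refine Finset.sum_congr rfl fun i _ => ?_
  rw [← hm.secondMoment_estErr_star hρtr j l i, conjTranspose_secondMoment]

lemma errCov_coercive (hρtr : 0 < ρtr) (j : Fin L) (x : Fin M → ℂ) :
    1 / ρul * normSq x ≤ (star x ⬝ᵥ errCov ρtr ρul R j *ᵥ x).re := by
  rw [re_errCov, le_add_iff_nonneg_left]
  refine Finset.sum_nonneg fun l _ => Finset.sum_nonneg fun i _ => ?_
  rw [← hm.secondMoment_estErr_star hρtr j l i,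
    re_star_dotProduct_secondMoment (hm.hasAllMoments_estErr j l i)]
  positivity

lemma re_errCov_le (hρtr : 0 < ρtr) {j : Fin L} {r : ℝ} (hr : ∀ l i, specNorm (R j l i) ≤ r)
    (x : Fin M → ℂ) :
    (star x ⬝ᵥ errCov ρtr ρul R j *ᵥ x).re ≤ (L * (K * r) + 1 / ρul) * normSq x := by
  have h1 : ∀ l i, (star x ⬝ᵥ (R j l i - estCov ρtr R j l i) *ᵥ x).re ≤ r * normSq x := by
    intro l i
    rw [← hm.secondMoment_estErr_star hρtr j l i,
      re_star_dotProduct_secondMoment (hm.hasAllMoments_estErr j l i)]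
    exact hm.integral_norm_sq_estErr_le hρtr (hr l i) x
  rw [re_errCov, add_mul]
  gcongr
  refine (Finset.sum_le_sum fun l _ => Finset.sum_le_sum fun i _ => h1 l i).trans_eq ?_
  simp [mul_assoc]

/-! ### Joint Gaussianity and independence -/

omit [IsProbabilityMeasure P] in
lemma integral_pilotObs (j : Fin L) (i : Fin K) (m : Fin M) :
    ∫ ω, pilotObs ρtr h n j i ω m ∂P = 0 := by
  have hh := fun l => ((hm.channel j l i).hasAllMoments.eval m).integrable
  have hn := ((hm.noise j i).hasAllMoments.eval m).integrable
  simp only [pilotObs, Pi.add_apply, Finset.sum_apply, Pi.smul_apply, smul_eq_mul]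
  rw [integral_add (integrable_finsetSum _ fun l _ => hh l) (hn.const_mul _),
    integral_finsetSum _ fun l _ => hh l, integral_const_mul, (hm.noise j i).mean]
  simp [(hm.channel j _ i).mean]

lemma integral_estErr (j l : Fin L) (i : Fin K) (m : Fin M) :
    ∫ ω, estErr ρtr R h n j l i ω m ∂P = 0 := by
  have hy := fun m => ((hm.hasAllMoments_pilotObs (ρtr := ρtr) j i).eval m).integrable
  have he := ((hm.hasAllMoments_channelEst (ρtr := ρtr) j l i).eval m).integrable
  simp only [estErr, Pi.sub_apply]
  rw [integral_sub ((hm.channel j l i).hasAllMoments.eval m).integrable he,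
    (hm.channel j l i).mean, zero_sub, neg_eq_zero]
  simp only [channelEst_eq, Matrix.mulVec, dotProduct]
  rw [integral_finsetSum _ fun m' _ => (hy m').const_mul _]
  refine Finset.sum_eq_zero fun m' _ => ?_
  rw [integral_const_mul, hm.integral_pilotObs, mul_zero]

omit [IsProbabilityMeasure P] in
/-- All real-linear images of the channels and noise vectors at a base station are Gaussian. -/
lemma hasGaussianLaw_clm {E : Type*} [NormedAddCommGroup E] [NormedSpace ℝ E] [MeasurableSpace E]
    [BorelSpace E] (j : Fin L) (T : ((Fin L × Fin K) ⊕ Fin K → Fin M → ℂ) →L[ℝ] E) :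
    HasGaussianLaw (fun ω => T (jointVec h n j ω)) P := by
  refine HasGaussianLaw.map_fun ((hm.indep j).hasGaussianLaw fun s => ?_) T
  rcases s with q | i
  · exact (hm.channel j q.1 q.2).gaussian
  · exact (hm.noise j i).gaussian

omit [IsProbabilityMeasure P] in
lemma hasGaussianLaw_pilotObs (j : Fin L) (i : Fin K) :
    HasGaussianLaw (pilotObs ρtr h n j i) P := by
  rw [funext (pilotObs_eq_pilotCLM (ρtr := ρtr) (h := h) (n := n) j i)]
  exact hm.hasGaussianLaw_clm j _

lemma indepFun_pilotObs (hρtr : 0 < ρtr) (j : Fin L) {i i' : Fin K} (hi : i ≠ i') :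
    IndepFun (pilotObs ρtr h n j i) (pilotObs ρtr h n j i') P := by
  refine indepFun_of_secondMoment_eq_zero ?_ (hm.integral_pilotObs j i)
    (hm.secondMoment_pilotObs_pilotObs j i i')
    ((hm.secondMoment_pilotObs_star_pilotObs hρtr j i i').trans (if_neg hi))
  simp only [pilotObs_eq_pilotCLM]
  exact hm.hasGaussianLaw_clm j ((pilotCLM L M ρtr i).prod (pilotCLM L M ρtr i'))

/-- The estimation error is independent of all pilot observations at the base station. -/
lemma indepFun_estErr (hρtr : 0 < ρtr) (j l : Fin L) (i : Fin K) :
    IndepFun (estErr ρtr R h n j l i)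
      (fun ω (p : Fin K × Fin M) => pilotObs ρtr h n j p.1 ω p.2) P := by
  refine indepFun_of_secondMoment_eq_zero ?_ (hm.integral_estErr j l i) ?_ ?_
  · simp only [estErr, channelEst_eq, pilotObs_eq_pilotCLM]
    let W : (Fin M → ℂ) →L[ℝ] (Fin M → ℂ) :=
      ((Matrix.mulVecLin (estMatrix ρtr R j l i)).restrictScalars ℝ).toContinuousLinearMap
    exact hm.hasGaussianLaw_clm j
      (((ContinuousLinearMap.proj (Sum.inl (l, i))) - W.comp (pilotCLM L M ρtr i)).prod
        (ContinuousLinearMap.pi fun p : Fin K × Fin M =>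
          (ContinuousLinearMap.proj (R := ℝ) (φ := fun _ => ℂ) p.2).comp (pilotCLM L M ρtr p.1)))
  · ext m p
    exact congrFun (congrFun (hm.secondMoment_estErr_pilotObs j l i p.1) m) p.2
  · ext m p
    exact congrFun (congrFun (hm.secondMoment_estErr_star_pilotObs hρtr j l i p.1) m) p.2

end IsChannelModel

end Model

/-! ### The residual of the M-MMSE filter -/

section Residual

variable {Ω : Type*} [MeasurableSpace Ω] {P : Measure Ω}

lemma integral_quadraticForm {M : ℕ} {Y : Ω → Fin M → ℂ} (hY : HasAllMoments Y P)
    (C : Matrix (Fin M) (Fin M) ℂ) :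
    ∫ ω, star (Y ω) ⬝ᵥ C *ᵥ Y ω ∂P = (C * secondMoment P Y (fun ω => star (Y ω))).trace := by
  have h : ∀ m k, Integrable (fun ω => star (Y ω m) * (C m k * Y ω k)) P := fun m k => by
    refine (((hY.eval k).mul (hY.star_comp.eval m)).integrable.const_mul (C m k)).congr
      (ae_of_all _ fun ω => ?_)
    simp only [Pi.star_apply]
    ring
  simp only [dotProduct, Matrix.mulVec, Finset.mul_sum, Pi.star_apply, Matrix.trace, Matrix.diag,
    Matrix.mul_apply]
  rw [integral_finsetSum _ fun m _ => integrable_finsetSum _ fun k _ => h m k]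
  refine Finset.sum_congr rfl fun m _ => ?_
  rw [integral_finsetSum _ fun k _ => h m k]
  refine Finset.sum_congr rfl fun k _ => ?_
  rw [secondMoment, Matrix.of_apply, ← integral_const_mul]
  exact integral_congr_ae (ae_of_all _ fun ω => by simp only [Pi.star_apply]; ring)

lemma integral_norm_const_sub_sq [IsProbabilityMeasure P] {Y : Ω → ℂ} (hY : HasAllMoments Y P)
    (c : ℂ) :
    ∫ ω, ‖c - Y ω‖ ^ 2 ∂P = ‖c - ∫ ω, Y ω ∂P‖ ^ 2 + (∫ ω, ‖Y ω‖ ^ 2 ∂P - ‖∫ ω, Y ω ∂P‖ ^ 2) := by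
  have h1 : ∀ a b : ℂ, ‖a - b‖ ^ 2 = ‖a‖ ^ 2 + ‖b‖ ^ 2 - 2 * (star a * b).re := by
    intro a b
    rw [Complex.sq_norm, Complex.sq_norm, Complex.sq_norm, Complex.normSq_sub]
    simp
  have hI : Integrable (fun ω => star c * Y ω) P := hY.integrable.const_mul _
  have h2 := integral_re hI
  simp only [RCLike.re_eq_complex_re] at h2
  simp_rw [h1 c]
  rw [integral_sub (by exact (integrable_const _).add hY.integrable_norm_sq)
      (Integrable.const_mul (f := fun ω => (star c * Y ω).re) hI.re 2),
    integral_add (integrable_const _) hY.integrable_norm_sq, integral_const_mul, h2,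
    integral_const_mul, integral_const]
  simp
  ring

variable {L K M : ℕ} {R : Fin L → Fin L → Fin K → Matrix (Fin M) (Fin M) ℂ}
  {h : Fin L → Fin L → Fin K → Ω → Fin M → ℂ} {n : Fin L → Fin K → Ω → Fin M → ℂ} {ρtr ρul : ℝ}

omit [MeasurableSpace Ω] in
lemma combiner_eq (j : Fin L) (k : Fin K) (ω : Ω) :
    combiner ρtr ρul R h n j k ω
      = mmseFilter (fun a : Fin L × Fin K => channelEst ρtr R h n j a.1 a.2 ω)
        (errCov ρtr ρul R j) (j, k) := by
  rw [combiner, mmseFilter, gramPlus, Fintype.sum_prod_type]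

/-- The gain `ĥ_{jjk}ᴴ v_{jk}` of the combining vector on the estimated channel. -/
def combinerGain (ρtr ρul : ℝ) (R : Fin L → Fin L → Fin K → Matrix (Fin M) (Fin M) ℂ)
    (h : Fin L → Fin L → Fin K → Ω → Fin M → ℂ) (n : Fin L → Fin K → Ω → Fin M → ℂ)
    (j : Fin L) (k : Fin K) (ω : Ω) : ℝ :=
  mmseGain (fun a : Fin L × Fin K => channelEst ρtr R h n j a.1 a.2 ω) (errCov ρtr ρul R j) (j, k)

namespace IsChannelModel

variable [IsProbabilityMeasure P] (hm : IsChannelModel P R h n) (hρtr : 0 < ρtr) (hρul : 0 < ρul)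
include hm hρtr hρul

lemma combinerGain_mem_Icc (j : Fin L) (k : Fin K) (ω : Ω) :
    combinerGain ρtr ρul R h n j k ω ∈ Set.Icc (0 : ℝ) 1 :=
  mmseGain_mem_Icc (one_div_pos.2 hρul) (hm.isHermitian_errCov hρtr j)
    (hm.errCov_coercive hρtr j) _

lemma star_channelEst_dotProduct_combiner (j : Fin L) (k : Fin K) (ω : Ω) :
    star (channelEst ρtr R h n j j k ω) ⬝ᵥ combiner ρtr ρul R h n j k ω
      = (combinerGain ρtr ρul R h n j k ω : ℂ) := by
  rw [combiner_eq]
  exact star_dotProduct_mmseFilter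
    (g := fun a : Fin L × Fin K => channelEst ρtr R h n j a.1 a.2 ω)
    (one_div_pos.2 hρul) (hm.isHermitian_errCov hρtr j) (hm.errCov_coercive hρtr j) (j, k)

lemma normSq_combiner_le (j : Fin L) (k : Fin K) (ω : Ω) :
    normSq (combiner ρtr ρul R h n j k ω) ≤ ρul * (1 - combinerGain ρtr ρul R h n j k ω) := by
  have h1 := normSq_mmseFilter_le
    (g := fun a : Fin L × Fin K => channelEst ρtr R h n j a.1 a.2 ω)
    (one_div_pos.2 hρul) (hm.isHermitian_errCov hρtr j) (hm.errCov_coercive hρtr j) (j, k)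
  rw [← combiner_eq, one_div, inv_mul_le_iff₀ hρul] at h1
  exact h1

/-- The combining vector is a continuous function of the pilot observations. -/
lemma exists_continuous_combiner (j : Fin L) (k : Fin K) :
    ∃ φ : (Fin K × Fin M → ℂ) → Fin M → ℂ, Continuous φ ∧
      ∀ ω, combiner ρtr ρul R h n j k ω = φ (fun p => pilotObs ρtr h n j p.1 ω p.2) := by
  refine ⟨fun y => mmseFilter (fun a : Fin L × Fin K =>
    estMatrix ρtr R j a.1 a.2 *ᵥ fun m => y (a.2, m)) (errCov ρtr ρul R j) (j, k),
    (continuous_mmseFilter (one_div_pos.2 hρul) (hm.errCov_coercive hρtr j) (j, k)).comp ?_,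
    combiner_eq j k⟩
  exact continuous_pi fun a => continuous_const.matrix_mulVec
    (continuous_pi fun m => continuous_apply _)

lemma hasAllMoments_combiner (j : Fin L) (k : Fin K) :
    HasAllMoments (combiner ρtr ρul R h n j k) P := by
  obtain ⟨φ, hφ, hφe⟩ := hm.exists_continuous_combiner hρtr hρul j k
  have hy : AEMeasurable (fun ω (p : Fin K × Fin M) => pilotObs ρtr h n j p.1 ω p.2) P :=
    aemeasurable_pi_lambda _ fun p => ((hm.hasAllMoments_pilotObs j p.1).eval p.2).aemeasurable
  have hv : AEMeasurable (combiner ρtr ρul R h n j k) P := by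
    rw [funext hφe]
    exact hφ.measurable.comp_aemeasurable hy
  refine .of_eval fun m p _ => MemLp.of_bound
    ((measurable_pi_apply m).comp_aemeasurable hv).aestronglyMeasurable (Real.sqrt ρul)
    (ae_of_all _ fun ω => Real.le_sqrt_of_sq_le ?_)
  have h1 : ‖combiner ρtr ρul R h n j k ω m‖ ^ 2 ≤ normSq (combiner ρtr ρul R h n j k ω) :=
    Finset.single_le_sum (f := fun m => ‖combiner ρtr ρul R h n j k ω m‖ ^ 2)
      (fun _ _ => by positivity) (Finset.mem_univ m)
  have h2 := hm.normSq_combiner_le hρtr hρul j k ω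
  have h3 := (hm.combinerGain_mem_Icc hρtr hρul j k ω).1
  nlinarith

lemma integrable_combinerGain (j : Fin L) (k : Fin K) :
    Integrable (combinerGain ρtr ρul R h n j k) P := by
  have h1 := ((hm.hasAllMoments_channelEst (ρtr := ρtr) j j k).star_comp.dotProduct
    (hm.hasAllMoments_combiner hρtr hρul j k)).integrable.re
  refine h1.congr (ae_of_all _ fun ω => ?_)
  simp only [hm.star_channelEst_dotProduct_combiner hρtr hρul, RCLike.re_eq_complex_re,
    Complex.ofReal_re]

/-- The mean residual `E[1 - ĥ_{jjk}ᴴ v_{jk}]` is of order `1 / M`. The competitor in the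
minimisation property of the filter is `u = B y_{jk} / M`, where `B` is dual to `R_{jjk}` among the
covariance matrices of the users that share the pilot. -/
lemma integral_one_sub_combinerGain_le (hM : 0 < M) {j : Fin L} {k : Fin K} {r δ : ℝ} (hr0 : 0 ≤ r)
    (hr : ∀ l i, specNorm (R j l i) ≤ r) (hδ : 0 < δ)
    (hind : ∀ (l' : Fin L) (c : Fin L → ℝ), c l' = 1 →
      δ ≤ 1 / (M : ℝ) * frobeniusNorm (∑ l, ((c l : ℝ) : ℂ) • R j l k) ^ 2) :
    ∫ ω, (1 - combinerGain ρtr ρul R h n j k ω) ∂P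
      ≤ (L * r + 1 / ρtr) * (2 * (L * (K * r)) + (L * (K * r) + 1 / ρul)) / δ / M := by
  obtain ⟨B, hB, hBR, hBδ⟩ := exists_dual_combination (fun l => R j l k)
    (fun l => (hm.channel j l k).isHermitian) hδ hind j
  set q := (L * r + 1 / ρtr : ℝ) with hq
  have hq0 : 0 ≤ q := by positivity
  set b := frobeniusNorm B ^ 2 with hb
  have hb0 : 0 ≤ b := by positivity
  set y := pilotObs ρtr h n j k with hy_def
  have hy : HasAllMoments y P := hm.hasAllMoments_pilotObs j k
  have hyq : ∀ x, ∫ ω, ‖star x ⬝ᵥ y ω‖ ^ 2 ∂P ≤ q * normSq x :=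
    hm.integral_norm_sq_pilotObs_le hρtr fun l => hr l k
  have hBy : ∫ ω, normSq (B *ᵥ y ω) ∂P ≤ q * b := integral_normSq_mulVec_le hy hyq B
  set u : Ω → Fin M → ℂ := fun ω => (1 / (M : ℂ)) • (B *ᵥ y ω) with hu_def
  have hu : HasAllMoments u P := (hy.mulVec B).smul _
  have hMn : ‖(1 / (M : ℂ))‖ ^ 2 = 1 / (M : ℝ) ^ 2 := by simp
  have hMstar : star (1 / (M : ℂ)) = 1 / (M : ℂ) := by simp
  have hest := fun a : Fin L × Fin K => hm.hasAllMoments_channelEst (ρtr := ρtr) j a.1 a.2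
  have hue : ∀ a : Fin L × Fin K, ∀ ω, star (u ω) ⬝ᵥ channelEst ρtr R h n j a.1 a.2 ω
      = (1 / (M : ℂ)) * (star (B *ᵥ y ω) ⬝ᵥ channelEst ρtr R h n j a.1 a.2 ω) := by
    intro a ω
    rw [hu_def, star_smul, hMstar, smul_dotProduct, smul_eq_mul]
  have hterm : ∀ a : Fin L × Fin K,
      ∫ ω, ‖(if a = (j, k) then 1 else 0) - star (u ω) ⬝ᵥ channelEst ρtr R h n j a.1 a.2 ω‖ ^ 2 ∂P
        ≤ 1 / (M : ℝ) ^ 2 * (2 * q * (r * b)) := by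
    rintro ⟨l, i⟩
    by_cases hi : i = k
    · -- A user of the same pilot: the form `uᴴ ĥ` is quadratic in the pilot observation and its
      -- mean is `tr (B R_{jlk}) / M`.
      subst hi
      set C := B * estMatrix ρtr R j l i with hC
      have hquad : ∀ ω, star (B *ᵥ y ω) ⬝ᵥ channelEst ρtr R h n j l i ω
          = star (y ω) ⬝ᵥ C *ᵥ y ω := by
        intro ω
        rw [channelEst_eq, Matrix.star_mulVec, hB.eq, ← Matrix.dotProduct_mulVec,
          Matrix.mulVec_mulVec]
      have hmean : (1 / (M : ℂ)) * ∫ ω, star (y ω) ⬝ᵥ C *ᵥ y ω ∂P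
          = if (l, i) = (j, i) then 1 else 0 := by
        rw [integral_quadraticForm hy, hm.secondMoment_pilotObs_star_pilotObs hρtr, if_pos rfl, hC,
          Matrix.mul_assoc, hm.estMatrix_mul_pilotCov hρtr, hBR l]
        simp
      have hs : ∫ ω, normSq (C *ᵥ y ω) ∂P ≤ r * b := by
        have h1 := integral_normSq_mulVec_le (hest (l, i))
          (hm.integral_norm_sq_channelEst_le hρtr (hr l i)) B
        simp_rw [channelEst_eq, Matrix.mulVec_mulVec] at h1
        exact h1
      have hvar := variance_quadraticForm_le (hm.hasGaussianLaw_pilotObs j i)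
        (hm.integral_pilotObs j i) C hq0 hyq hs
      have heq : ∀ ω, ‖(if (l, i) = (j, i) then 1 else 0)
            - star (u ω) ⬝ᵥ channelEst ρtr R h n j l i ω‖ ^ 2
          = 1 / (M : ℝ) ^ 2 * ‖star (y ω) ⬝ᵥ C *ᵥ y ω
            - ∫ ω', star (y ω') ⬝ᵥ C *ᵥ y ω' ∂P‖ ^ 2 := by
        intro ω
        rw [hue (l, i), hquad, ← hmean, ← mul_sub, norm_mul, mul_pow, hMn, norm_sub_rev]
      simp_rw [heq]
      rw [integral_const_mul]
      gcongr
    · -- A user of another pilot: the estimate is independent of `u`.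
      have hne : (l, i) ≠ (j, k) := fun he => hi (congrArg Prod.snd he)
      have hindep : IndepFun (channelEst ρtr R h n j l i) (fun ω => B *ᵥ y ω) P := by
        have h1 := hm.indepFun_pilotObs hρtr j hi
        have hc : ∀ A : Matrix (Fin M) (Fin M) ℂ, Measurable fun x : Fin M → ℂ => A *ᵥ x :=
          fun A => (continuous_const.matrix_mulVec continuous_id).measurable
        exact h1.comp (hc (estMatrix ρtr R j l i)) (hc B)
      have h2 := integral_norm_sq_star_dotProduct_le_of_indepFun (hest (l, i)) (hy.mulVec B) hindep
        (hm.integral_norm_sq_channelEst_le hρtr (hr l i))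
      simp_rw [if_neg hne, zero_sub, norm_neg, hue (l, i), norm_mul, mul_pow, hMn]
      rw [integral_const_mul]
      gcongr
      calc _ ≤ r * ∫ ω, normSq (B *ᵥ y ω) ∂P := h2
        _ ≤ r * (q * b) := by gcongr
        _ ≤ 2 * q * (r * b) := by nlinarith [mul_nonneg hq0 (mul_nonneg hr0 hb0)]
  have hnoise : ∫ ω, (L * (K * r) + 1 / ρul) * normSq (u ω) ∂P
      ≤ 1 / (M : ℝ) ^ 2 * ((L * (K * r) + 1 / ρul) * (q * b)) := by
    simp_rw [hu_def, normSq_smul, hMn]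
    rw [integral_const_mul, integral_const_mul]
    have : (L * (K * r) + 1 / ρul) * (1 / (M : ℝ) ^ 2 * ∫ ω, normSq (B *ᵥ y ω) ∂P)
        = 1 / (M : ℝ) ^ 2 * ((L * (K * r) + 1 / ρul) * ∫ ω, normSq (B *ᵥ y ω) ∂P) := by ring
    rw [this]
    gcongr
  have hIterm : ∀ a ∈ (Finset.univ : Finset (Fin L × Fin K)), Integrable (fun ω =>
      ‖(if a = (j, k) then 1 else 0) - star (u ω) ⬝ᵥ channelEst ρtr R h n j a.1 a.2 ω‖ ^ 2) P :=
    fun a _ => ((HasAllMoments.const _).sub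
      (hu.star_comp.dotProduct (hest a))).integrable_norm_sq
  have hInoise : Integrable (fun ω => (L * (K * r) + 1 / ρul) * normSq (u ω)) P :=
    hu.integrable_normSq.const_mul _
  calc ∫ ω, (1 - combinerGain ρtr ρul R h n j k ω) ∂P
      ≤ ∫ ω, (∑ a : Fin L × Fin K, ‖(if a = (j, k) then 1 else 0)
          - star (u ω) ⬝ᵥ channelEst ρtr R h n j a.1 a.2 ω‖ ^ 2
          + (L * (K * r) + 1 / ρul) * normSq (u ω)) ∂P := by
        refine integral_mono_of_nonneg
          (ae_of_all _ fun ω => sub_nonneg.2 (hm.combinerGain_mem_Icc hρtr hρul j k ω).2)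
          ((integrable_finsetSum _ hIterm).add hInoise) (ae_of_all _ fun ω => ?_)
        exact (one_sub_mmseGain_le
          (g := fun a : Fin L × Fin K => channelEst ρtr R h n j a.1 a.2 ω) (one_div_pos.2 hρul)
          (hm.isHermitian_errCov hρtr j) (hm.errCov_coercive hρtr j) (j, k) (u ω)).trans
          (add_le_add_right (hm.re_errCov_le hρtr hr (u ω)) _)
    _ ≤ ∑ _a : Fin L × Fin K, 1 / (M : ℝ) ^ 2 * (2 * q * (r * b))
          + 1 / (M : ℝ) ^ 2 * ((L * (K * r) + 1 / ρul) * (q * b)) := by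
        rw [integral_add (integrable_finsetSum _ hIterm) hInoise, integral_finsetSum _ hIterm]
        exact add_le_add (Finset.sum_le_sum fun a _ => hterm a) hnoise
    _ = q * (2 * (L * (K * r)) + (L * (K * r) + 1 / ρul)) * (1 / (M : ℝ) * b) / M := by
        simp only [Finset.sum_const, Finset.card_univ, Fintype.card_prod, Fintype.card_fin,
          nsmul_eq_mul, Nat.cast_mul]
        field_simp
    _ ≤ q * (2 * (L * (K * r)) + (L * (K * r) + 1 / ρul)) * (1 / δ) / M := by gcongr
    _ = _ := by ring

/-- Up to the estimation error, the beam of user `k` in cell `j` has unit gain at its own user and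
gain zero at every other user. -/
lemma integral_norm_sq_channel_combiner_le {j : Fin L} {l : Fin L} {i : Fin K} {r : ℝ}
    (hr : specNorm (R j l i) ≤ r) (k : Fin K) :
    ∫ ω, ‖(if (l, i) = (j, k) then 1 else 0)
        - star (h j l i ω) ⬝ᵥ combiner ρtr ρul R h n j k ω‖ ^ 2 ∂P
      ≤ 2 * ∫ ω, (1 - combinerGain ρtr ρul R h n j k ω) ∂P
        + 2 * (r * ∫ ω, normSq (combiner ρtr ρul R h n j k ω) ∂P) := by
  obtain ⟨φ, hφ, hφe⟩ := hm.exists_continuous_combiner hρtr hρul j k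
  have hv := hm.hasAllMoments_combiner hρtr hρul j k
  have he := hm.hasAllMoments_estErr (ρtr := ρtr) j l i
  have hindep : IndepFun (estErr ρtr R h n j l i) (combiner ρtr ρul R h n j k) P := by
    rw [funext hφe]
    exact (hm.indepFun_estErr hρtr j l i).comp measurable_id hφ.measurable
  have h1 := integral_norm_sq_star_dotProduct_le_of_indepFun he hv hindep
    (hm.integral_norm_sq_estErr_le hρtr hr)
  have hest : ∀ ω, ‖(if (l, i) = (j, k) then 1 else 0)
      - star (channelEst ρtr R h n j l i ω) ⬝ᵥ combiner ρtr ρul R h n j k ω‖ ^ 2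
      ≤ 1 - combinerGain ρtr ρul R h n j k ω := by
    intro ω
    by_cases ha : (l, i) = (j, k)
    · cases ha
      obtain ⟨h2, h3⟩ := hm.combinerGain_mem_Icc hρtr hρul j i ω
      rw [if_pos rfl, hm.star_channelEst_dotProduct_combiner hρtr hρul, ← Complex.ofReal_one,
        ← Complex.ofReal_sub, Complex.norm_real, Real.norm_eq_abs, sq_abs]
      nlinarith
    · have h2 := norm_sq_star_dotProduct_mmseFilter_le
        (g := fun a : Fin L × Fin K => channelEst ρtr R h n j a.1 a.2 ω) (one_div_pos.2 hρul)
        (hm.isHermitian_errCov (ρul := ρul) hρtr j) (hm.errCov_coercive hρtr j) ha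
      rw [← combiner_eq] at h2
      rw [if_neg ha, zero_sub, norm_neg]
      exact h2
  have hpt : ∀ ω, ‖(if (l, i) = (j, k) then 1 else 0)
        - star (h j l i ω) ⬝ᵥ combiner ρtr ρul R h n j k ω‖ ^ 2
      ≤ 2 * (1 - combinerGain ρtr ρul R h n j k ω)
        + 2 * ‖star (combiner ρtr ρul R h n j k ω) ⬝ᵥ estErr ρtr R h n j l i ω‖ ^ 2 := by
    intro ω
    have hdec : h j l i ω = channelEst ρtr R h n j l i ω + estErr ρtr R h n j l i ω := by
      rw [estErr, add_sub_cancel]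
    rw [hdec, star_add, add_dotProduct, ← sub_sub,
      norm_star_dotProduct_comm (combiner _ _ _ _ _ _ _ _)]
    set s := (if (l, i) = (j, k) then 1 else 0)
      - star (channelEst ρtr R h n j l i ω) ⬝ᵥ combiner ρtr ρul R h n j k ω
    set e := star (estErr ρtr R h n j l i ω) ⬝ᵥ combiner ρtr ρul R h n j k ω
    have h3 := hest ω
    have h4 := norm_sub_le s e
    have h5 := norm_nonneg (s - e)
    nlinarith [sq_nonneg (‖s‖ - ‖e‖)]
  have hI1 : Integrable (fun ω => 2 * (1 - combinerGain ρtr ρul R h n j k ω)) P :=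
    ((integrable_const 1).sub (hm.integrable_combinerGain hρtr hρul j k)).const_mul 2
  have hI2 : Integrable (fun ω =>
      2 * ‖star (combiner ρtr ρul R h n j k ω) ⬝ᵥ estErr ρtr R h n j l i ω‖ ^ 2) P :=
    (hv.star_comp.dotProduct he).integrable_norm_sq.const_mul 2
  refine (integral_mono_of_nonneg (ae_of_all _ fun ω => by positivity) (hI1.add hI2)
    (ae_of_all _ hpt)).trans ?_
  simp only [Pi.add_apply]
  rw [integral_add hI1 hI2, integral_const_mul, integral_const_mul]
  linarith

lemma integral_normSq_combiner_le (j : Fin L) (k : Fin K) :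
    ∫ ω, normSq (combiner ρtr ρul R h n j k ω) ∂P
      ≤ ρul * ∫ ω, (1 - combinerGain ρtr ρul R h n j k ω) ∂P := by
  rw [← integral_const_mul]
  exact integral_mono (hm.hasAllMoments_combiner hρtr hρul j k).integrable_normSq
    (((integrable_const 1).sub (hm.integrable_combinerGain hρtr hρul j k)).const_mul ρul)
    fun ω => hm.normSq_combiner_le hρtr hρul j k ω

/-- The power of the combining vector is at least of order `1 / M`. -/
lemma one_sub_le_integral_normSq_combiner (hM : 0 < M) {j : Fin L} {k : Fin K} {r : ℝ}
    (hr0 : 0 < r) (hr : specNorm (R j j k) ≤ r) :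
    1 - ∫ ω, (1 - combinerGain ρtr ρul R h n j k ω) ∂P
      ≤ 1 / 4 + r * M * ∫ ω, normSq (combiner ρtr ρul R h n j k ω) ∂P := by
  have hM' : (0 : ℝ) < M := Nat.cast_pos.2 hM
  have hest := hm.hasAllMoments_channelEst (ρtr := ρtr) j j k
  have hg := hm.integrable_combinerGain hρtr hρul j k
  have hv := hm.hasAllMoments_combiner hρtr hρul j k
  have hone : frobeniusNorm (1 : Matrix (Fin M) (Fin M) ℂ) ^ 2 = M := by
    rw [← re_trace_mul_self Matrix.isHermitian_one, mul_one, Matrix.trace_one]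
    simp
  have h1 := integral_normSq_mulVec_le hest (hm.integral_norm_sq_channelEst_le hρtr hr) 1
  simp only [Matrix.one_mulVec, hone] at h1
  -- `x ≤ ‖ĥ‖ ‖v‖ ≤ t ‖ĥ‖² / 2 + ‖v‖² / (2 t)` with `t = 1 / (2 r M)`
  have hpt : ∀ ω, combinerGain ρtr ρul R h n j k ω
      ≤ 1 / (4 * (r * M)) * normSq (channelEst ρtr R h n j j k ω)
        + r * M * normSq (combiner ρtr ρul R h n j k ω) := by
    intro ω
    have h2 := norm_star_dotProduct_sq_le (channelEst ρtr R h n j j k ω)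
      (combiner ρtr ρul R h n j k ω)
    rw [hm.star_channelEst_dotProduct_combiner hρtr hρul, Complex.norm_real, Real.norm_eq_abs,
      sq_abs] at h2
    have ha := normSq_nonneg (channelEst ρtr R h n j j k ω)
    have hb := normSq_nonneg (combiner ρtr ρul R h n j k ω)
    have ht : 0 < r * M := by positivity
    refine (le_abs_self _).trans (abs_le_of_sq_le_sq (h2.trans ?_)
      (add_nonneg (mul_nonneg (by positivity) ha) (mul_nonneg ht.le hb)))
    have h3 : 1 / (4 * (r * M)) * (r * M) = 1 / 4 := by field_simp
    nlinarith [sq_nonneg (1 / (4 * (r * M)) * normSq (channelEst ρtr R h n j j k ω)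
        - r * M * normSq (combiner ρtr ρul R h n j k ω)), mul_nonneg ha hb]
  have h4 := integral_mono hg
    ((hest.integrable_normSq.const_mul _).add (hv.integrable_normSq.const_mul (r * M))) hpt
  simp only [Pi.add_apply] at h4
  rw [integral_add (hest.integrable_normSq.const_mul _) (hv.integrable_normSq.const_mul _),
    integral_const_mul, integral_const_mul] at h4
  have h5 : 1 / (4 * (r * M)) * ∫ ω, normSq (channelEst ρtr R h n j j k ω) ∂P ≤ 1 / 4 := by
    calc _ ≤ 1 / (4 * (r * M)) * (r * M) := by gcongr
      _ = 1 / 4 := by field_simp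
  rw [integral_sub (integrable_const 1) hg]
  simp only [integral_const, probReal_univ, one_smul]
  linarith

end IsChannelModel

end Residual

/-! ### The downlink SINR -/

section Downlink

variable {Ω : Type*} [MeasurableSpace Ω] {P : Measure Ω}
  {L K M : ℕ} {R : Fin L → Fin L → Fin K → Matrix (Fin M) (Fin M) ℂ}
  {h : Fin L → Fin L → Fin K → Ω → Fin M → ℂ} {n : Fin L → Fin K → Ω → Fin M → ℂ} {ρtr ρul : ℝ}

/-- The mean power `E‖v_{jk}‖²` of the combining vector. -/
def combinerPower (P : Measure Ω) (ρtr ρul : ℝ)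
    (R : Fin L → Fin L → Fin K → Matrix (Fin M) (Fin M) ℂ)
    (h : Fin L → Fin L → Fin K → Ω → Fin M → ℂ) (n : Fin L → Fin K → Ω → Fin M → ℂ)
    (j : Fin L) (k : Fin K) : ℝ :=
  ∫ ω, normSq (combiner ρtr ρul R h n j k ω) ∂P

lemma combinerPower_nonneg (j : Fin L) (k : Fin K) : 0 ≤ combinerPower P ρtr ρul R h n j k :=
  integral_nonneg fun _ => normSq_nonneg _

lemma star_dotProduct_precoder (x : Fin M → ℂ) (j : Fin L) (k : Fin K) (ω : Ω) :
    star x ⬝ᵥ precoder P ρtr ρul R h n j k ω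
      = ((1 / Real.sqrt (combinerPower P ρtr ρul R h n j k) : ℝ) : ℂ)
        * (star x ⬝ᵥ combiner ρtr ρul R h n j k ω) := by
  rw [precoder, dotProduct_smul, smul_eq_mul, combinerPower]

lemma norm_sq_one_div_sqrt_combinerPower (j : Fin L) (k : Fin K) :
    ‖((1 / Real.sqrt (combinerPower P ρtr ρul R h n j k) : ℝ) : ℂ)‖ ^ 2
      = 1 / combinerPower P ρtr ρul R h n j k := by
  rw [Complex.norm_real, Real.norm_eq_abs, sq_abs, div_pow, one_pow,
    Real.sq_sqrt (combinerPower_nonneg j k)]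

lemma integral_norm_sq_star_dotProduct_precoder (X : Ω → Fin M → ℂ) (j : Fin L) (k : Fin K) :
    ∫ ω, ‖star (X ω) ⬝ᵥ precoder P ρtr ρul R h n j k ω‖ ^ 2 ∂P
      = 1 / combinerPower P ρtr ρul R h n j k
        * ∫ ω, ‖star (X ω) ⬝ᵥ combiner ρtr ρul R h n j k ω‖ ^ 2 ∂P := by
  simp_rw [star_dotProduct_precoder, norm_mul, mul_pow, norm_sq_one_div_sqrt_combinerPower]
  exact integral_const_mul _ _

lemma norm_sq_integral_star_dotProduct_precoder (X : Ω → Fin M → ℂ) (j : Fin L) (k : Fin K) :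
    ‖∫ ω, star (X ω) ⬝ᵥ precoder P ρtr ρul R h n j k ω ∂P‖ ^ 2
      = 1 / combinerPower P ρtr ρul R h n j k
        * ‖∫ ω, star (X ω) ⬝ᵥ combiner ρtr ρul R h n j k ω ∂P‖ ^ 2 := by
  simp_rw [star_dotProduct_precoder]
  rw [integral_const_mul, norm_mul, mul_pow, norm_sq_one_div_sqrt_combinerPower]

lemma integral_normSq_precoder (j : Fin L) (k : Fin K)
    (hp : combinerPower P ρtr ρul R h n j k ≠ 0) :
    ∫ ω, normSq (precoder P ρtr ρul R h n j k ω) ∂P = 1 := by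
  have h1 : ∀ ω, normSq (precoder P ρtr ρul R h n j k ω)
      = 1 / combinerPower P ρtr ρul R h n j k * normSq (combiner ρtr ρul R h n j k ω) := by
    intro ω
    rw [precoder, normSq_smul, ← norm_sq_one_div_sqrt_combinerPower, combinerPower]
  simp_rw [h1]
  rw [integral_const_mul]
  exact one_div_mul_cancel hp

namespace IsChannelModel

variable [IsProbabilityMeasure P] (hm : IsChannelModel P R h n) (hρtr : 0 < ρtr) (hρul : 0 < ρul)
include hm hρtr hρul

lemma hasAllMoments_star_dotProduct_precoder (l j : Fin L) (k i : Fin K) :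
    HasAllMoments (fun ω => star (h l j k ω) ⬝ᵥ precoder P ρtr ρul R h n l i ω) P := by
  simp_rw [star_dotProduct_precoder]
  exact (HasAllMoments.const _).mul
    ((hm.channel l j k).hasAllMoments.star_comp.dotProduct
      (hm.hasAllMoments_combiner hρtr hρul l i))

/-- Mean residuals of order `1 / M` make the beams powerful enough. -/
lemma one_div_le_combinerPower (hM : 0 < M) {r : ℝ} (hr0 : 0 < r) {j : Fin L} {k : Fin K}
    (hr : specNorm (R j j k) ≤ r)
    (hε : ∫ ω, (1 - combinerGain ρtr ρul R h n j k ω) ∂P ≤ 1 / 2) :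
    1 / (4 * r * M) ≤ combinerPower P ρtr ρul R h n j k := by
  have hM' : (0 : ℝ) < M := Nat.cast_pos.2 hM
  have h1 := hm.one_sub_le_integral_normSq_combiner hρtr hρul hM hr0 hr
  rw [div_le_iff₀ (by positivity), combinerPower]
  linarith

/-- A lower bound for the SINR from mean residuals of order `1 / M`: after normalisation every
interference term stays bounded, while the signal power grows linearly in `M`. -/
lemma le_downlinkSINR {ρdl : ℝ} (hρdl : 0 < ρdl) (hM : 0 < M) {r c : ℝ} (hr0 : 0 < r) (hc : 0 < c)
    (hr : ∀ j l i, specNorm (R j l i) ≤ r)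
    (hε : ∀ j k, ∫ ω, (1 - combinerGain ρtr ρul R h n j k ω) ∂P ≤ c / M)
    (hcM : 8 * (1 + r * ρul) * c ≤ M) (hcM' : 2 * c ≤ M) (j : Fin L) (k : Fin K) :
    1 / (4 * (ρul * c) * (L * (K * (8 * c * r + 2 * r)) + 1 / ρdl)) * M
      ≤ downlinkSINR P ρdl h (precoder P ρtr ρul R h n) j k := by
  have hM' : (0 : ℝ) < M := Nat.cast_pos.2 hM
  set p := combinerPower P ρtr ρul R h n with hp
  set I := ∫ ω, star (h j j k ω) ⬝ᵥ combiner ρtr ρul R h n j k ω ∂P with hI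
  set κ := 8 * c * r + 2 * r with hκ
  have hκ0 : 0 ≤ κ := by positivity
  have hp_ge : ∀ l i, 1 / (4 * r * M) ≤ p l i := fun l i => by
    refine hm.one_div_le_combinerPower hρtr hρul hM hr0 (hr l l i) ((hε l i).trans ?_)
    rw [div_le_iff₀ hM']
    linarith
  have hp_pos : ∀ l i, 0 < p l i := fun l i => lt_of_lt_of_le (by positivity) (hp_ge l i)
  have hp_le : ∀ l i, p l i ≤ ρul * (c / M) := fun l i =>
    (hm.integral_normSq_combiner_le hρtr hρul l i).trans
      (mul_le_mul_of_nonneg_left (hε l i) hρul.le)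
  have hY : ∀ l i, HasAllMoments
      (fun ω => star (h l j k ω) ⬝ᵥ combiner ρtr ρul R h n l i ω) P := fun l i =>
    (hm.channel l j k).hasAllMoments.star_comp.dotProduct (hm.hasAllMoments_combiner hρtr hρul l i)
  -- the mean squared deviation of each effective gain from its target
  have hη : ∀ l i, ∫ ω, ‖(if (j, k) = (l, i) then 1 else 0)
      - star (h l j k ω) ⬝ᵥ combiner ρtr ρul R h n l i ω‖ ^ 2 ∂P
      ≤ 2 * (c / M) + 2 * (r * p l i) := fun l i =>
    (hm.integral_norm_sq_channel_combiner_le hρtr hρul (hr l j k) i).trans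
      (by rw [hp, combinerPower]; linarith [hε l i])
  have hηκ : ∀ l i, 1 / p l i * (2 * (c / M) + 2 * (r * p l i)) ≤ κ := by
    intro l i
    have h1 := hp_pos l i
    have h2 : 1 / (p l i * M) ≤ 4 * r := by
      rw [div_le_iff₀ (by positivity)]
      have := hp_ge l i
      rw [div_le_iff₀ (by positivity)] at this
      linarith
    calc 1 / p l i * (2 * (c / M) + 2 * (r * p l i))
        = 2 * c * (1 / (p l i * M)) + 2 * r := by field_simp
      _ ≤ 2 * c * (4 * r) + 2 * r := by gcongr
      _ = κ := by rw [hκ]; ring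
  have hown := integral_norm_const_sub_sq (hY j k) 1
  have hown' := hη j k
  rw [if_pos rfl, hown, ← hI] at hown'
  have hvar : ‖I‖ ^ 2 ≤ ∫ ω, ‖star (h j j k ω) ⬝ᵥ combiner ρtr ρul R h n j k ω‖ ^ 2 ∂P := by
    have h1 := integral_norm_const_sub_sq (hY j k) I
    rw [← hI, sub_self, norm_zero] at h1
    have h2 : 0 ≤ ∫ ω, ‖I - star (h j j k ω) ⬝ᵥ combiner ρtr ρul R h n j k ω‖ ^ 2 ∂P := by
      positivity
    linarith
  -- the mean gain at the own user is at least one half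
  have hI_ge : 1 / 4 ≤ ‖I‖ ^ 2 := by
    have h1 : ‖1 - I‖ ^ 2 ≤ (1 / 2) ^ 2 := by
      have h2 : 2 * (c / M) + 2 * (r * p j k) ≤ (1 / 2) ^ 2 := by
        calc 2 * (c / M) + 2 * (r * p j k) ≤ 2 * (c / M) + 2 * (r * (ρul * (c / M))) := by
              gcongr
              exact hp_le j k
          _ = 2 * (1 + r * ρul) * c / M := by ring
          _ ≤ (1 / 2) ^ 2 := by
              rw [div_le_iff₀ hM']
              linarith
      linarith
    have h3 := abs_le_of_sq_le_sq h1 (by norm_num)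
    rw [abs_of_nonneg (norm_nonneg _)] at h3
    have h4 := norm_sub_norm_le (1 : ℂ) I
    rw [norm_one] at h4
    nlinarith
  -- the denominator, written as a sum over all beams of nonnegative terms
  have hterm : ∀ l i, ∫ ω, ‖star (h l j k ω) ⬝ᵥ precoder P ρtr ρul R h n l i ω‖ ^ 2 ∂P
      - (if (j, k) = (l, i) then 1 / p j k * ‖I‖ ^ 2 else 0) ∈ Set.Icc 0 κ := by
    intro l i
    rw [integral_norm_sq_star_dotProduct_precoder]
    by_cases ha : (j, k) = (l, i)
    · cases ha
      rw [if_pos rfl, ← hp, ← mul_sub]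
      refine ⟨mul_nonneg (one_div_nonneg.2 (hp_pos j k).le) (sub_nonneg.2 hvar), ?_⟩
      refine le_trans (mul_le_mul_of_nonneg_left ?_ (one_div_nonneg.2 (hp_pos j k).le)) (hηκ j k)
      linarith [sq_nonneg ‖1 - I‖]
    · rw [if_neg ha, sub_zero, ← hp]
      have h1 := hp_pos l i
      refine ⟨by positivity, le_trans (mul_le_mul_of_nonneg_left ?_ (one_div_nonneg.2 h1.le))
        (hηκ l i)⟩
      have h2 := hη l i
      simp only [if_neg ha, zero_sub, norm_neg] at h2
      exact h2
  have hden : ∑ l, ∑ i, ∫ ω, ‖star (h l j k ω) ⬝ᵥ precoder P ρtr ρul R h n l i ω‖ ^ 2 ∂P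
        - 1 / p j k * ‖I‖ ^ 2
      = ∑ l, ∑ i, (∫ ω, ‖star (h l j k ω) ⬝ᵥ precoder P ρtr ρul R h n l i ω‖ ^ 2 ∂P
        - (if (j, k) = (l, i) then 1 / p j k * ‖I‖ ^ 2 else 0)) := by
    simp only [Finset.sum_sub_distrib]
    congr 1
    rw [← Fintype.sum_prod_type' (fun l i => if (j, k) = (l, i) then 1 / p j k * ‖I‖ ^ 2 else 0)]
    simp
  have hden0 : 0 ≤ ∑ l, ∑ i, ∫ ω, ‖star (h l j k ω) ⬝ᵥ precoder P ρtr ρul R h n l i ω‖ ^ 2 ∂P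
        - 1 / p j k * ‖I‖ ^ 2 := by
    rw [hden]
    exact Finset.sum_nonneg fun l _ => Finset.sum_nonneg fun i _ => (hterm l i).1
  have hden1 : ∑ l, ∑ i, ∫ ω, ‖star (h l j k ω) ⬝ᵥ precoder P ρtr ρul R h n l i ω‖ ^ 2 ∂P
        - 1 / p j k * ‖I‖ ^ 2 ≤ L * (K * κ) := by
    rw [hden]
    refine (Finset.sum_le_sum fun l _ => Finset.sum_le_sum fun i _ => (hterm l i).2).trans_eq ?_
    simp
  have hpinv : 1 / (ρul * c) * M ≤ 1 / p j k := by
    calc 1 / (ρul * c) * M = 1 / (ρul * (c / M)) := by field_simp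
      _ ≤ 1 / p j k := one_div_le_one_div_of_le (hp_pos j k) (hp_le j k)
  rw [downlinkSINR, norm_sq_integral_star_dotProduct_precoder, ← hI, ← hp]
  have hpos : 0 < 1 / ρdl := by positivity
  have hcpos : 0 < 1 / (ρul * c) * M := by positivity
  calc 1 / (4 * (ρul * c) * (L * (K * κ) + 1 / ρdl)) * M
      = 1 / (ρul * c) * M * (1 / 4) / (L * (K * κ) + 1 / ρdl) := by
        have : 0 < L * (K * κ) + 1 / ρdl := by positivity
        field_simp
    _ ≤ _ := by
        apply div_le_div₀
        · exact mul_nonneg (one_div_nonneg.2 (hp_pos j k).le) (sq_nonneg _)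
        · exact mul_le_mul hpinv hI_ge (by norm_num) (one_div_nonneg.2 (hp_pos j k).le)
        · linarith
        · linarith

end IsChannelModel

end Downlink

/-! ### Uniform constants in the asymptotic assumptions -/

section Asymptotics

variable {L K : ℕ} {R : (M : ℕ) → Fin L → Fin L → Fin K → Matrix (Fin M) (Fin M) ℂ}

lemma BoundedEnergy.exists_specNorm_le (hR : BoundedEnergy R) :
    ∃ r : ℝ, 0 < r ∧ ∀ᶠ M in atTop, ∀ j l i, specNorm (R M j l i) ≤ r := by
  have h1 : ∀ q : Fin L × Fin L × Fin K, ∃ r : ℝ,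
      ∀ᶠ M in atTop, specNorm (R M q.1 q.2.1 q.2.2) ≤ r := by
    intro q
    obtain ⟨r, hr, -⟩ := EReal.lt_iff_exists_real_btwn.1 (hR q.1 q.2.1 q.2.2).2
    exact ⟨r, (eventually_lt_of_limsup_lt hr).mono fun M hM => (EReal.coe_lt_coe_iff.1 hM).le⟩
  choose r hr using h1
  obtain ⟨r', hr', hr0⟩ := ((eventually_all.2 fun q => eventually_ge_atTop (r q)).and
    (eventually_gt_atTop (0 : ℝ))).exists
  refine ⟨r', hr0, (eventually_all.2 hr).mono fun M hM j l i => ?_⟩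
  exact (hM (j, l, i)).trans (hr' (j, l, i))

lemma AsymptoticallyIndependent.exists_le (hR : AsymptoticallyIndependent R) :
    ∃ δ : ℝ, 0 < δ ∧ ∀ᶠ M : ℕ in atTop, ∀ j k (l' : Fin L) (c : Fin L → ℝ), c l' = 1 →
      δ ≤ 1 / (M : ℝ) * frobeniusNorm (∑ l, ((c l : ℝ) : ℂ) • R M j l k) ^ 2 := by
  have h1 : ∀ q : Fin L × Fin K × Fin L, ∃ δ : ℝ, 0 < δ ∧ ∀ᶠ M : ℕ in atTop,
      ∀ c : Fin L → ℝ, c q.2.2 = 1 →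
        δ ≤ 1 / (M : ℝ) * frobeniusNorm (∑ l, ((c l : ℝ) : ℂ) • R M q.1 l q.2.1) ^ 2 := by
    intro q
    obtain ⟨δ, hδ0, hδ⟩ := EReal.lt_iff_exists_real_btwn.1 (hR q.1 q.2.1 q.2.2)
    refine ⟨δ, EReal.coe_pos.1 hδ0, (eventually_lt_of_lt_liminf hδ).mono fun M hM c hc => ?_⟩
    exact EReal.coe_le_coe_iff.1 (hM.le.trans (iInf₂_le c hc))
  choose δ hδ0 hδ using h1
  obtain ⟨δ', hδ', hδ'0⟩ := ((eventually_all.2 fun q =>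
    (Ioo_mem_nhdsGT (hδ0 q) : ∀ᶠ t in nhdsWithin 0 (Set.Ioi 0), t ∈ Set.Ioo 0 (δ q))).and
    (self_mem_nhdsWithin : Set.Ioi (0 : ℝ) ∈ nhdsWithin 0 (Set.Ioi 0))).exists
  refine ⟨δ', hδ'0, (eventually_all.2 hδ).mono fun M hM j k l' c hc => ?_⟩
  exact (hδ' (j, k, l')).2.le.trans (hM (j, k, l') c hc)

lemma tendsto_spectralEfficiency {τp τc : ℕ} (hτ : τp < τc) {ι : Type*} {l : Filter ι} {γ : ι → ℝ}
    (hγ : Tendsto γ l atTop) :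
    Tendsto (fun M => spectralEfficiency τp τc (γ M)) l atTop := by
  have h1 : (0 : ℝ) < 1 - (τp : ℝ) / (τc : ℝ) := by
    rw [sub_pos, div_lt_one (by exact_mod_cast (Nat.zero_le _).trans_lt hτ)]
    exact_mod_cast hτ
  exact ((Real.tendsto_logb_atTop (by norm_num)).comp
    (tendsto_atTop_add_const_left l 1 hγ)).const_mul_atTop h1

end Asymptotics

end MulticellMIMO

end

theorem theorem5 {L K : ℕ} (τc : ℕ) (hτ : K < τc)
    (ρtr ρul ρdl : ℝ) (hρtr : 0 < ρtr) (hρul : 0 < ρul) (hρdl : 0 < ρdl)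
    (R : (M : ℕ) → Fin L → Fin L → Fin K → Matrix (Fin M) (Fin M) ℂ)
    {Ω : ℕ → Type*} [∀ M, MeasurableSpace (Ω M)]
    (P : (M : ℕ) → Measure (Ω M)) [∀ M, IsProbabilityMeasure (P M)]
    (h : (M : ℕ) → Fin L → Fin L → Fin K → Ω M → Fin M → ℂ)
    (n : (M : ℕ) → Fin L → Fin K → Ω M → Fin M → ℂ)
    (hmodel : ∀ M, MulticellMIMO.IsChannelModel (P M) (R M) (h M) (n M))
    (hR : MulticellMIMO.BoundedEnergy R)
    (hRindep : MulticellMIMO.AsymptoticallyIndependent R)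
    (w : (M : ℕ) → Fin L → Fin K → Ω M → Fin M → ℂ)
    (hw : ∀ M, w M = MulticellMIMO.precoder (P M) ρtr ρul (R M) (h M) (n M)) :
    -- all the expectations in the precoder and in the SINR exist
    (∀ M (l : Fin L) (i : Fin K),
      Integrable (fun ω =>
        MulticellMIMO.normSq (MulticellMIMO.combiner ρtr ρul (R M) (h M) (n M) l i ω)) (P M) ∧
      ∀ (j : Fin L) (k : Fin K),
        Integrable (fun ω => star (h M l j k ω) ⬝ᵥ w M l i ω) (P M) ∧
        Integrable (fun ω => ‖star (h M l j k ω) ⬝ᵥ w M l i ω‖ ^ 2) (P M)) ∧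
    -- the precoders have unit average power as soon as `M` is large
    (∀ (j : Fin L) (k : Fin K), ∀ᶠ M in atTop,
      ∫ ω, MulticellMIMO.normSq (w M j k ω) ∂(P M) = 1) ∧
    -- the SINR and the spectral efficiency of every user diverge
    ∀ (j : Fin L) (k : Fin K),
      Tendsto (fun M => MulticellMIMO.downlinkSINR (P M) ρdl (h M) (w M) j k) atTop atTop ∧
      Tendsto (fun M => MulticellMIMO.spectralEfficiency K τc
        (MulticellMIMO.downlinkSINR (P M) ρdl (h M) (w M) j k)) atTop atTop := by
  have hw' : w = fun M => MulticellMIMO.precoder (P M) ρtr ρul (R M) (h M) (n M) := funext hw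
  subst hw'
  obtain ⟨r, hr0, hr⟩ := hR.exists_specNorm_le
  obtain ⟨δ, hδ, hind⟩ := hRindep.exists_le
  set c : ℝ := (L * r + 1 / ρtr) * (2 * (L * (K * r)) + (L * (K * r) + 1 / ρul)) / δ with hc
  have hc0 : 0 < c := by positivity
  have hlarge : ∀ᶠ M : ℕ in atTop, 0 < M ∧ 8 * (1 + r * ρul) * c ≤ M ∧ 2 * c ≤ M :=
    (eventually_gt_atTop 0).and ((tendsto_natCast_atTop_atTop.eventually_ge_atTop _).and
      (tendsto_natCast_atTop_atTop.eventually_ge_atTop _))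
  have hε : ∀ᶠ M : ℕ in atTop, ∀ j k,
      ∫ ω, (1 - MulticellMIMO.combinerGain ρtr ρul (R M) (h M) (n M) j k ω) ∂(P M) ≤ c / M := by
    filter_upwards [hr, hind, hlarge] with M hrM hindM hM j k
    exact (hmodel M).integral_one_sub_combinerGain_le hρtr hρul hM.1 hr0.le (hrM j) hδ (hindM j k)
  have hSINR : ∀ j k, Tendsto (fun M => MulticellMIMO.downlinkSINR (P M) ρdl (h M)
      (MulticellMIMO.precoder (P M) ρtr ρul (R M) (h M) (n M)) j k) atTop atTop := by
    intro j k
    have hlin : Tendsto (fun M : ℕ =>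
        1 / (4 * (ρul * c) * (L * (K * (8 * c * r + 2 * r)) + 1 / ρdl)) * (M : ℝ)) atTop atTop :=
      tendsto_natCast_atTop_atTop.const_mul_atTop (by positivity)
    refine tendsto_atTop_mono' _ ?_ hlin
    filter_upwards [hr, hε, hlarge] with M hrM hεM hM
    exact (hmodel M).le_downlinkSINR hρtr hρul hρdl hM.1 hr0 hc0 hrM hεM hM.2.1 hM.2.2 j k
  refine ⟨fun M l i => ⟨((hmodel M).hasAllMoments_combiner hρtr hρul l i).integrable_normSq,
    fun j k => ?_⟩, fun j k => ?_, fun j k =>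
    ⟨hSINR j k, MulticellMIMO.tendsto_spectralEfficiency hτ (hSINR j k)⟩⟩
  · have h1 := (hmodel M).hasAllMoments_star_dotProduct_precoder hρtr hρul l j k i
    exact ⟨h1.integrable, h1.integrable_norm_sq⟩
  · filter_upwards [hr, hε, hlarge] with M hrM hεM hM
    have hM' : (0 : ℝ) < M := Nat.cast_pos.2 hM.1
    refine MulticellMIMO.integral_normSq_precoder j k (ne_of_gt (lt_of_lt_of_le ?_
      ((hmodel M).one_div_le_combinerPower hρtr hρul hM.1 hr0 (hrM j j k) ((hεM j k).trans ?_))))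
    · positivity
    · rw [div_le_iff₀ hM']
      linarith [hM.2.2]
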